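/- Let $\mathfrak g$ be a finite-dimensional complex simple Lie algebra with Cartan subalgebra $\mathfrak h$, simple roots $\alpha_1,\dots,\alpha_r$, invariant form $(\cdot,\cdot)$ on $\mathfrak h^*$ normalized by $(\alpha,\alpha)=2$ for short roots, $d_i=(\alpha_i,\alpha_i)/2$, Cartan matrix $(\alpha_i,\alpha_j)=d_ia_{ij}$, and half-sum of positive roots $\rho$. Let $q>0$, $q\neq1$ be real, $q_i=q^{d_i}$. Let $U_q(\mathfrak g)$ be the Hopf $*$-algebra generated by $E_i,F_i,K_i^{\pm1}$ with relations $K_iK_j=K_jK_i$, $K_iE_jK_i^{-1}=q_i^{a_{ij}}E_j$, $K_iF_jK_i^{-1}=q_i^{-a_{ij}}F_j$, $E_iF_j-F_jE_i=\delta_{ij}\frac{K_i-K_i^{-1}}{q_i-q_i^{-1}}$ and the quantum Serre relations, with $\Delta(K_i)=K_i\otimes K_i$, $\Delta(E_i)=E_i\otimes K_i+1\otimes E_i$, $\Delta(F_i)=F_i\otimes1+K_i^{-1}\otimes F_i$, antipode $S$, counit $\varepsilon$, and $K_i^*=K_i$, $E_i^*=K_iF_i$, $F_i^*=E_iK_i^{-1}$.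 For $2\rho=\sum_in_i\alpha_i$ put $K_{2\rho}=\prod_iK_i^{n_i}$. Let $\mathbb C_q[G]\subset U_q(\mathfrak g)^*$ be the $*$-algebra spanned by the matrix coefficients of the finite-dimensional (type 1, i.e. spanned by vectors of integral weight) representations of $U_q(\mathfrak g)$, with $(\phi\psi)(X)=(\phi\otimes\psi)(\Delta(X))$, $\phi^*(X)=\overline{\phi(S(X)^*)}$; it is a left and a right $U_q(\mathfrak g)$-module algebra by $(X\triangleright\phi)(Y)=\phi(YX)$ and $(\phi\triangleleft X)(Y)=\phi(XY)$. Let $\mathcal U$ be a Hopf algebra with bijective antipode and $\mathcal B$ a right (respectively left) $\mathcal U$-module algebra. Given anti-homomorphisms $\rho^\circ:\mathcal U\to\mathrm{Mat}_N(\mathbb C)$, $\sigma^\circ:\mathcal U\to\mathrm{Mat}_K(\mathbb C)$, a matrix $M\in\mathrm{Mat}_{N\times K}(\mathcal B)$ is called right (respectively left) invariant if for all $X\in\mathcal U$ $$\rho^\circ(X_{(1)})\,(M\triangleleft X_{(2)})\,\sigma^\circ(S^{-1}(X_{(3)}))=\varepsilon(X)M,$$ respectively $$\rho^\circ(S^{-1}(X_{(1)}))\,(S^{-2}(X_{(2)})\triangleright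 M)\,\sigma^\circ(X_{(3)})=\varepsilon(X)M .$$ An invariant projection is an idempotent $P\in\mathrm{Mat}_N(\mathcal B)$ with an anti-homomorphism $\rho^\circ$ for which $P$ is invariant (with $\sigma^\circ=\rho^\circ$). Two of them, $P$ and $P'$, are equivalent if $P=xy$, $P'=yx$ for invariant rectangular matrices $x,y$. The Grothendieck group of equivalence classes of right (respectively left) invariant projections under direct sum is denoted ${}^{\mathcal U}K_0(\mathcal B)$ (respectively $K_0(\mathcal B)^{\mathcal U}$). Let $\pi:U_q(\mathfrak g)\to\mathrm{End}(V(\Lambda))$ be a finite-dimensional irreducible representation of dominant integral highest weight $\Lambda$ that is unitary ($\langle\pi(X)v,w\rangle=\langle v,\pi(X^*)w\rangle$), let $v_1,\dots,v_N$ be an orthonormal basis with dual basis $f^1,\dots,f^N$, and let $u^i_j(X)=f^i(\pi(X)v_j)$. Define $\mathsf M^n_m,\mathsf N^n_m\in\mathrm{Mat}_N(\mathbb C_q[G])$ by $$(\mathsf M^n_m)^i_j=(u^m_i)^*u^n_j,\qquad(\mathsf N^n_m)^i_j=u^i_m(u^j_n)^*,$$ and, for $c^m_n\in\mathbb C$,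 let $\mathsf P=\sum_{m,n}c^m_n\mathsf M^n_m$ and $\mathsf Q=\sum_{m,n}c^m_n\mathsf N^n_m$. Then: 1) $\rho^\circ(X)=\pi(K_{2\rho}^{-1}S(X)K_{2\rho})$ (written as a matrix in the basis $v_i$) is an anti-homomorphism, every $\mathsf M^n_m$ is left $U_q(\mathfrak g)$-invariant with respect to it, and if $\mathsf P$ is a projection, then $\mathsf P$ with $\rho^\circ$ is a left invariant projection and so defines a class in $K_0(\mathbb C_q[G])^{U_q(\mathfrak g)}$. 2) $\rho^\circ(X)=\pi(K_{2\rho}S^{-1}(X)K_{2\rho}^{-1})$ is an anti-homomorphism, every $\mathsf N^n_m$ is right $U_q(\mathfrak g)$-invariant with respect to it, and if $\mathsf Q$ is a projection, then $\mathsf Q$ with $\rho^\circ$ is a right invariant projection and so defines a class in ${}^{U_q(\mathfrak g)}K_0(\mathbb C_q[G])$. -/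

import Mathlib

open scoped TensorProduct InnerProductSpace

noncomputable section

namespace QuantumGroup

/-! ### Quantum integers and the Serre expressions -/

/-- The `q`-integer `[n]_q = (q^n - q^{-n}) / (q - q^{-1})`. -/
def qInt (q : ℂ) (n : ℕ) : ℂ := (q ^ n - (q ^ n)⁻¹) / (q - q⁻¹)

/-- The `q`-factorial `[n]_q! = [1]_q [2]_q ⋯ [n]_q`. -/
def qFact (q : ℂ) (n : ℕ) : ℂ := ∏ k ∈ Finset.range n, qInt q (k + 1)

/-- The `q`-binomial coefficient (for `k ≤ n`). -/
def qBinom (q : ℂ) (n k : ℕ) : ℂ := qFact q n / (qFact q k * qFact q (n - k))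

/-- The quantum Serre expression `∑ₖ (-1)ᵏ [m choose k]_q e^{m-k} x eᵏ`. -/
def serre {R : Type*} [Ring R] [Algebra ℂ R] (q : ℂ) (m : ℕ) (e x : R) : R :=
  ∑ k ∈ Finset.range (m + 1), ((-1) ^ k * qBinom q m k) • (e ^ (m - k) * x * e ^ k)

section SerreLemmas

variable {R : Type*} [Ring R] [Algebra ℂ R]

theorem qInt_inv (q : ℂ) (n : ℕ) : qInt q⁻¹ n = qInt q n := by
  unfold qInt
  rw [inv_pow, inv_inv, inv_inv, ← neg_sub (q ^ n), ← neg_sub q, neg_div_neg_eq]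

theorem qBinom_inv (q : ℂ) (n k : ℕ) : qBinom q⁻¹ n k = qBinom q n k := by
  simp [qBinom, qFact, qInt_inv]

theorem qBinom_symm (q : ℂ) {n k : ℕ} (h : k ≤ n) : qBinom q n (n - k) = qBinom q n k := by
  simp [qBinom, Nat.sub_sub_self h, mul_comm]

theorem serre_inv (q : ℂ) (m : ℕ) (e x : R) : serre q⁻¹ m e x = serre q m e x := by
  simp [serre, qBinom_inv]

theorem qFact_succ (q : ℂ) (n : ℕ) : qFact q (n + 1) = qFact q n * qInt q (n + 1) := by
  simp [qFact, Finset.prod_range_succ]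

/-- `q` is nonzero and not a root of unity. -/
def Generic (q : ℂ) : Prop := q ≠ 0 ∧ ∀ n : ℕ, 0 < n → q ^ n ≠ 1

theorem Generic.inv {q : ℂ} (h : Generic q) : Generic q⁻¹ :=
  ⟨inv_ne_zero h.1, fun n hn => by
    rw [inv_pow, Ne, inv_eq_one]
    exact h.2 n hn⟩

theorem Generic.sub_ne {q : ℂ} (h : Generic q) : q - q⁻¹ ≠ 0 := by
  intro h0
  have h1 : q * (q - q⁻¹) = 0 := by rw [h0, mul_zero]
  rw [mul_sub, mul_inv_cancel₀ h.1] at h1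
  exact h.2 2 (by norm_num) (by linear_combination h1)

theorem Generic.qInt_ne {q : ℂ} (h : Generic q) {n : ℕ} (hn : 0 < n) : qInt q n ≠ 0 := by
  refine div_ne_zero ?_ h.sub_ne
  intro h0
  have h1 : q ^ n * (q ^ n - (q ^ n)⁻¹) = 0 := by rw [h0, mul_zero]
  rw [mul_sub, mul_inv_cancel₀ (pow_ne_zero _ h.1)] at h1
  exact h.2 (2 * n) (by omega) (by rw [two_mul, pow_add]; linear_combination h1)

theorem Generic.qFact_ne {q : ℂ} (h : Generic q) (n : ℕ) : qFact q n ≠ 0 :=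
  Finset.prod_ne_zero_iff.2 fun _ _ => h.qInt_ne (Nat.succ_pos _)

theorem qBinom_zero {q : ℂ} (h : Generic q) (n : ℕ) : qBinom q n 0 = 1 := by
  have := h.qFact_ne n
  simp only [qBinom, Nat.sub_zero]
  rw [show qFact q 0 = 1 by simp [qFact], one_mul, div_self this]

theorem qBinom_self {q : ℂ} (h : Generic q) (n : ℕ) : qBinom q n n = 1 := by
  have := qBinom_symm q (Nat.zero_le n)
  rwa [Nat.sub_zero, qBinom_zero h] at this

/-- The `q`-Pascal rule. -/
theorem qBinom_pascal {q : ℂ} (h : Generic q) {m k : ℕ} (hk : k + 1 ≤ m) :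
    qBinom q (m + 1) (k + 1) =
      (q⁻¹) ^ (k + 1) * qBinom q m (k + 1) + q ^ (m - k) * qBinom q m k := by
  obtain ⟨l, rfl⟩ := Nat.exists_eq_add_of_le hk
  have e1 : k + 1 + l + 1 - (k + 1) = l + 1 := by omega
  have e2 : k + 1 + l - (k + 1) = l := by omega
  have e3 : k + 1 + l - k = l + 1 := by omega
  simp only [qBinom, e1, e2, e3]
  rw [qFact_succ q (k + 1 + l), qFact_succ q k, qFact_succ q l]
  have h1 := h.qFact_ne k
  have h2 := h.qFact_ne l
  have h3 := h.qInt_ne (Nat.succ_pos k)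
  have h4 := h.qInt_ne (Nat.succ_pos l)
  have key : qInt q (k + 1 + l + 1) =
      (q⁻¹) ^ (k + 1) * qInt q (l + 1) + q ^ (l + 1) * qInt q (k + 1) := by
    have h5 := h.sub_ne
    have h6 := h.1
    have h7 : q ^ 2 - 1 ≠ 0 := sub_ne_zero.2 (h.2 2 (by norm_num))
    unfold qInt
    rw [mul_div_assoc', mul_div_assoc', ← add_div]
    congr 1
    rw [inv_pow]
    field_simp
    ring
  rw [key]
  field_simp

/-- The Serre expression with an additional scaling parameter. -/
def serreT (q : ℂ) (m : ℕ) (t : ℂ) (e x : R) : R :=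
  ∑ k ∈ Finset.range (m + 1), ((-1) ^ k * qBinom q m k * t ^ k) • (e ^ (m - k) * x * e ^ k)

theorem serreT_succ {q : ℂ} (h : Generic q) (m : ℕ) (t : ℂ) (e x : R) :
    serreT q (m + 1) t e x =
      e * serreT q m (t * q⁻¹) e x - (t * q ^ m) • (serreT q m (t * q⁻¹) e x * e) := by
  unfold serreT
  rw [Finset.mul_sum, Finset.sum_mul, Finset.smul_sum]
  rw [Finset.sum_range_succ', Finset.sum_range_succ,
    Finset.sum_range_succ' (fun k => e * _), Finset.sum_range_succ (fun k => (t * q ^ m) • _)]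
  have hmid : ∀ k ∈ Finset.range m,
      ((-1) ^ (k + 1) * qBinom q (m + 1) (k + 1) * t ^ (k + 1)) •
        (e ^ (m + 1 - (k + 1)) * x * e ^ (k + 1)) =
      e * (((-1) ^ (k + 1) * qBinom q m (k + 1) * (t * q⁻¹) ^ (k + 1)) •
        (e ^ (m - (k + 1)) * x * e ^ (k + 1))) -
      (t * q ^ m) • (((-1) ^ k * qBinom q m k * (t * q⁻¹) ^ k) •
        (e ^ (m - k) * x * e ^ k) * e) := by
    intro k hk
    have hk' : k + 1 ≤ m := Finset.mem_range.1 hk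
    rw [qBinom_pascal h hk', mul_smul_comm, smul_mul_assoc, smul_smul]
    have a1 : e * (e ^ (m - (k + 1)) * x * e ^ (k + 1)) = e ^ (m - k) * x * e ^ (k + 1) := by
      rw [← mul_assoc, ← mul_assoc, ← pow_succ']
      congr 4
      omega
    have a2 : e ^ (m - k) * x * e ^ k * e = e ^ (m - k) * x * e ^ (k + 1) := by
      rw [mul_assoc, ← pow_succ]
    have a3 : m + 1 - (k + 1) = m - k := by omega
    rw [a1, a2, a3, ← sub_smul]
    congr 1
    have hq := h.1
    have a4 : q ^ m = q ^ (m - k) * q ^ k := by rw [← pow_add]; congr 1; omega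
    rw [a4, mul_pow, mul_pow]
    have a5 : q ^ k * q⁻¹ ^ k = 1 := by rw [← mul_pow, mul_inv_cancel₀ hq, one_pow]
    rw [pow_succ (-1 : ℂ) k, pow_succ t k]
    linear_combination ((-1 : ℂ) ^ k * t * t ^ k * q ^ (m - k) * qBinom q m k) * a5
  rw [Finset.sum_congr rfl hmid, Finset.sum_sub_distrib]
  have hlast : ((-1) ^ (m + 1) * qBinom q (m + 1) (m + 1) * t ^ (m + 1)) •
        (e ^ (m + 1 - (m + 1)) * x * e ^ (m + 1)) =
      -((t * q ^ m) • (((-1) ^ m * qBinom q m m * (t * q⁻¹) ^ m) •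
        (e ^ (m - m) * x * e ^ m) * e)) := by
    rw [qBinom_self h, qBinom_self h, smul_mul_assoc, smul_smul, ← neg_smul, Nat.sub_self,
      Nat.sub_self, mul_assoc, mul_assoc (e ^ 0 * x), ← pow_succ, ← mul_assoc]
    congr 1
    have a5 : q ^ m * q⁻¹ ^ m = 1 := by rw [← mul_pow, mul_inv_cancel₀ h.1, one_pow]
    rw [mul_pow]
    linear_combination (t * (-1) ^ m * t ^ m) * a5
  have hfirst : ((-1) ^ 0 * qBinom q (m + 1) 0 * t ^ 0) • (e ^ (m + 1 - 0) * x * e ^ 0) =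
      e * (((-1) ^ 0 * qBinom q m 0 * (t * q⁻¹) ^ 0) • (e ^ (m - 0) * x * e ^ 0)) := by
    simp [qBinom_zero h, pow_succ', mul_assoc]
  rw [hlast, hfirst]
  abel

/-- Iterated `q`-commutators: `w₀ = x`, `wᵣ₊₁ = e wᵣ - u vʳ wᵣ e`. -/
def qComm (u v : ℂ) (e x : R) : ℕ → R
  | 0 => x
  | r + 1 => e * qComm u v e x r - (u * v ^ r) • (qComm u v e x r * e)

theorem serreT_eq_qComm {q : ℂ} (h : Generic q) (e x : R) (m : ℕ) :
    ∀ t u : ℂ, u * q ^ m = t * q → serreT q m t e x = qComm u (q ^ 2) e x m := by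
  induction m with
  | zero => intro t u _; simp [serreT, qComm, qBinom_zero h]
  | succ m ih =>
    intro t u hu
    have hq := h.1
    have hu' : u * q ^ m = t := mul_right_cancel₀ hq (by rw [mul_assoc, ← pow_succ, hu])
    rw [serreT_succ h, ih (t * q⁻¹) u (by rw [inv_mul_cancel_right₀ hq, hu']), qComm]
    congr 2
    rw [← hu', ← pow_mul]
    ring

theorem serre_eq_qComm {q : ℂ} (h : Generic q) (e x : R) (m : ℕ) (u : ℂ) (hu : u * q ^ m = q) :
    serre q m e x = qComm u (q ^ 2) e x m := by
  rw [← serreT_eq_qComm h e x m 1 u (by rw [one_mul, hu])]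
  simp [serre, serreT]

theorem qComm_add (u v : ℂ) (a b x : R) (hx : b * x = u • (x * b)) (ha : b * a = v • (a * b))
    (m : ℕ) : qComm u v (a + b) x m = qComm u v a x m ∧
      b * qComm u v a x m = (u * v ^ m) • (qComm u v a x m * b) := by
  induction m with
  | zero => simpa [qComm] using hx
  | succ m ih =>
    obtain ⟨h1, h2⟩ := ih
    constructor
    · rw [qComm, qComm, h1, add_mul, mul_add, h2, smul_add]
      abel
    · rw [qComm, mul_sub, sub_mul, mul_smul_comm, ← mul_assoc, ha, smul_mul_assoc, mul_assoc, h2,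
        ← mul_assoc, h2, smul_mul_assoc, smul_mul_assoc, mul_assoc, ha]
      simp only [mul_smul_comm, smul_smul, smul_sub, mul_assoc]
      congr 2 <;> ring

/-- If `b` `q`-commutes past `x` and `a` with the right constants, then `b` drops out. -/
theorem serre_add {q : ℂ} (h : Generic q) (m : ℕ) (u : ℂ) (a b x : R)
    (hu : u * q ^ m = q) (hx : b * x = u • (x * b)) (ha : b * a = (q ^ 2) • (a * b)) :
    serre q m (a + b) x = serre q m a x := by
  rw [serre_eq_qComm h _ _ _ u hu, serre_eq_qComm h _ _ _ u hu]
  exact (qComm_add u _ a b x hx ha m).1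

theorem qComm_mul (u v α γ : ℂ) (p k x l : R) (hkl : l * k = k * l)
    (hkp : k * p = α • (p * k)) (hkx : k * x = γ • (x * k)) (hlp : l * p = γ • (p * l)) (m : ℕ) :
    k * qComm u v p x m = (γ * α ^ m) • (qComm u v p x m * k) ∧
    k ^ m * l * p = (γ * α ^ m) • (p * (k ^ m * l)) ∧
    ∃ c : ℂ, qComm u v (p * k) (x * l) m = c • (qComm u v p x m * (k ^ m * l)) := by
  induction m with
  | zero =>
    refine ⟨by simpa [qComm] using hkx, by simpa using hlp, 1, by simp [qComm]⟩
  | succ m ih =>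
    obtain ⟨h1, h2, c, h3⟩ := ih
    refine ⟨?_, ?_, c * (γ * α ^ m), ?_⟩
    · rw [qComm, mul_sub, sub_mul, mul_smul_comm, ← mul_assoc, hkp, smul_mul_assoc, mul_assoc, h1,
        ← mul_assoc, h1, smul_mul_assoc, smul_mul_assoc, mul_assoc, hkp]
      simp only [mul_smul_comm, smul_smul, smul_sub, mul_assoc]
      congr 2 <;> ring
    · rw [pow_succ', mul_assoc, mul_assoc, ← mul_assoc _ l, h2, mul_smul_comm, ← mul_assoc, hkp,
        smul_mul_assoc, smul_smul, pow_succ α]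
      simp only [mul_assoc]
    · have e1 : p * k * (qComm u v p x m * (k ^ m * l)) =
          (γ * α ^ m) • (p * qComm u v p x m * (k ^ (m + 1) * l)) := by
        rw [mul_assoc, ← mul_assoc k, h1, pow_succ']
        simp only [smul_mul_assoc, mul_smul_comm, mul_assoc]
      have e2 : qComm u v p x m * (k ^ m * l) * (p * k) =
          (γ * α ^ m) • (qComm u v p x m * p * (k ^ (m + 1) * l)) := by
        rw [mul_assoc, ← mul_assoc _ p, h2, smul_mul_assoc, mul_smul_comm, mul_assoc, mul_assoc,
          hkl, ← mul_assoc (k ^ m), ← pow_succ, mul_assoc]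
      rw [qComm, h3, mul_smul_comm, smul_mul_assoc, e1, e2, qComm, sub_mul, smul_mul_assoc,
        smul_sub]
      simp only [smul_smul]
      congr 2
      ring

theorem serre_mul_eq_zero {q : ℂ} (h : Generic q) (m : ℕ) (α γ : ℂ) (p k x l : R)
    (hkl : l * k = k * l) (hkp : k * p = α • (p * k)) (hkx : k * x = γ • (x * k))
    (hlp : l * p = γ • (p * l)) (h0 : serre q m p x = 0) : serre q m (p * k) (x * l) = 0 := by
  have hu : (q * (q ^ m)⁻¹) * q ^ m = q := inv_mul_cancel_right₀ (pow_ne_zero _ h.1) _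
  rw [serre_eq_qComm h _ _ _ _ hu] at h0 ⊢
  obtain ⟨c, hc⟩ := (qComm_mul (q * (q ^ m)⁻¹) (q ^ 2) α γ p k x l hkl hkp hkx hlp m).2.2
  rw [hc, h0, zero_mul, smul_zero]

theorem serre_smul (q : ℂ) (m : ℕ) (c d : ℂ) (e x : R) :
    serre q m (c • e) (d • x) = (c ^ m * d) • serre q m e x := by
  unfold serre
  rw [Finset.smul_sum]
  refine Finset.sum_congr rfl fun k hk => ?_
  have hk' : k ≤ m := Nat.lt_succ_iff.1 (Finset.mem_range.1 hk)
  simp only [smul_pow, smul_mul_assoc, mul_smul_comm, smul_smul]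
  congr 1
  have : c ^ m = c ^ (m - k) * c ^ k := by rw [← pow_add, Nat.sub_add_cancel hk']
  rw [this]
  ring

theorem serre_op (q : ℂ) (m : ℕ) (e x : R) :
    serre q m (MulOpposite.op e) (MulOpposite.op x) =
      (-1 : ℂ) ^ m • MulOpposite.op (serre q m e x) := by
  unfold serre
  rw [← Finset.sum_range_reflect, ← MulOpposite.op_smul, Finset.smul_sum, Finset.op_sum]
  refine Finset.sum_congr rfl fun k hk => ?_
  have hk' : k ≤ m := Nat.lt_succ_iff.1 (Finset.mem_range.1 hk)
  have e1 : m + 1 - 1 - k = m - k := by omega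
  rw [e1, qBinom_symm q hk', Nat.sub_sub_self hk', smul_smul, MulOpposite.op_smul,
    MulOpposite.op_mul, MulOpposite.op_mul, MulOpposite.op_pow, MulOpposite.op_pow, mul_assoc]
  congr 1
  have : (-1 : ℂ) ^ m = (-1) ^ (m - k) * (-1) ^ k := by rw [← pow_add, Nat.sub_add_cancel hk']
  have h2 : (-1 : ℂ) ^ k * (-1) ^ k = 1 := by rw [← mul_pow]; simp
  rw [this]
  linear_combination (-(-1 : ℂ) ^ (m - k) * qBinom q m k) * h2

theorem map_serre {R' : Type*} [Ring R'] [Algebra ℂ R'] (f : R →ₐ[ℂ] R') (q : ℂ) (m : ℕ)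
    (e x : R) : f (serre q m e x) = serre q m (f e) (f x) := by
  simp [serre, map_sum]

end SerreLemmas

theorem serre_add_right {R : Type*} [Ring R] [Algebra ℂ R] (q : ℂ) (m : ℕ) (e x y : R) :
    serre q m e (x + y) = serre q m e x + serre q m e y := by
  simp [serre, mul_add, add_mul, Finset.sum_add_distrib]

theorem serre_coprod {R : Type*} [Ring R] [Algebra ℂ R] {q : ℂ} (h : Generic q) (m : ℕ) (u : ℂ)
    (hu : u * q ^ m = q) (a b x y : R) (hx : x * b = u • (b * x)) (hy : a * y = u • (y * a))
    (hab : a * b = (q ^ 2) • (b * a)) (h1 : serre q m a x = 0) (h2 : serre q m b y = 0) :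
    serre q m (a + b) (x + y) = 0 := by
  have hq := h.1
  have hu0 : u ≠ 0 := by
    rintro rfl
    rw [zero_mul] at hu
    exact hq hu.symm
  have e1 : serre q m (a + b) x = serre q m a x := by
    rw [← serre_inv, ← serre_inv q m a]
    refine serre_add h.inv m u⁻¹ a b x ?_ ?_ ?_
    · rw [inv_pow, ← mul_inv, hu]
    · rw [hx, smul_smul, inv_mul_cancel₀ hu0, one_smul]
    · rw [hab, smul_smul, inv_pow, inv_mul_cancel₀ (pow_ne_zero _ hq), one_smul]
  have e2 : serre q m (a + b) y = serre q m b y := by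
    rw [add_comm a b]
    exact serre_add h m u b a y hu hy hab
  rw [serre_add_right, e1, e2, h1, h2, add_zero]

/-! ### Cartan data and quantized enveloping algebras -/

/-- The numerical data entering the definition of `U_q(𝔤)`: a generalized Cartan matrix `(a_ij)`,
numbers `d_i > 0` with `d_i a_ij = d_j a_ji`, and a real number `q > 0`, `q ≠ 1`. -/
structure Datum (ι : Type*) where
  a : ι → ι → ℤ
  d : ι → ℝ
  q : ℝ
  a_diag : ∀ i, a i i = 2
  a_nonpos : ∀ i j, i ≠ j → a i j ≤ 0
  d_pos : ∀ i, 0 < d i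
  symm : ∀ i j, d i * a i j = d j * a j i
  q_pos : 0 < q
  q_ne_one : q ≠ 1

namespace Datum

variable {ι : Type*} (D : Datum ι)

/-- `q_i = q ^ d_i`. -/
def qi (i : ι) : ℂ := ((D.q ^ D.d i : ℝ) : ℂ)

theorem qi_real_pos (i : ι) : 0 < D.q ^ D.d i := Real.rpow_pos_of_pos D.q_pos _

theorem qi_ne_zero (i : ι) : D.qi i ≠ 0 := Complex.ofReal_ne_zero.2 (D.qi_real_pos i).ne'

theorem qi_generic (i : ι) : Generic (D.qi i) := by
  refine ⟨D.qi_ne_zero i, fun n hn h => ?_⟩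
  rw [qi, ← Complex.ofReal_pow, Complex.ofReal_eq_one, pow_eq_one_iff_of_nonneg
    (D.qi_real_pos i).le hn.ne'] at h
  have h2 := congrArg Real.log h
  rw [Real.log_rpow D.q_pos, Real.log_one] at h2
  exact (mul_ne_zero (D.d_pos i).ne' (Real.log_ne_zero_of_pos_of_ne_one D.q_pos D.q_ne_one)) h2

theorem conj_qi (i : ι) : (starRingEnd ℂ) (D.qi i) = D.qi i := Complex.conj_ofReal _

theorem qi_symm (i j : ι) : D.qi i ^ D.a i j = D.qi j ^ D.a j i := by
  rw [qi, qi, ← Complex.ofReal_zpow, ← Complex.ofReal_zpow, ← Real.rpow_intCast,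
    ← Real.rpow_intCast, ← Real.rpow_mul D.q_pos.le, ← Real.rpow_mul D.q_pos.le, D.symm]

/-- The degree `1 - a_ij` of the Serre relation (only used for `i ≠ j`, where it is positive). -/
def serreDeg (i j : ι) : ℕ := (1 - D.a i j).toNat

theorem qi_serreDeg {i j : ι} (h : i ≠ j) : D.qi i ^ D.a i j * D.qi i ^ D.serreDeg i j = D.qi i := by
  have h1 := D.a_nonpos i j h
  rw [← zpow_natCast, ← zpow_add₀ (D.qi_ne_zero i), serreDeg, Int.toNat_of_nonneg (by omega)]
  simp

open scoped Classical in
/-- A family of elements of an algebra satisfying the defining relations of `U_q(𝔤)`. -/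
structure Relations {R : Type*} [Ring R] [Algebra ℂ R] (e f k k' : ι → R) :
    Prop where
  kk' : ∀ i, k i * k' i = 1
  k'k : ∀ i, k' i * k i = 1
  comm : ∀ i j, k i * k j = k j * k i
  ke : ∀ i j, k i * e j * k' i = (D.qi i ^ D.a i j) • e j
  kf : ∀ i j, k i * f j * k' i = (D.qi i ^ (-D.a i j)) • f j
  ef : ∀ i j, e i * f j - f j * e i =
    if i = j then (D.qi i - (D.qi i)⁻¹)⁻¹ • (k i - k' i) else 0
  serreE : ∀ i j, i ≠ j → serre (D.qi i) (D.serreDeg i j) (e i) (e j) = 0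
  serreF : ∀ i j, i ≠ j → serre (D.qi i) (D.serreDeg i j) (f i) (f j) = 0

/-- The generators of `U_q(𝔤)`; `K'` stands for the inverse of `K`. -/
inductive Gen (ι : Type*)
  | E : ι → Gen ι
  | F : ι → Gen ι
  | K : ι → Gen ι
  | K' : ι → Gen ι

/-- The free generators. -/
abbrev fE (i : ι) : FreeAlgebra ℂ (Gen ι) := FreeAlgebra.ι ℂ (Gen.E i)

/-- The free generators. -/
abbrev fF (i : ι) : FreeAlgebra ℂ (Gen ι) := FreeAlgebra.ι ℂ (Gen.F i)

/-- The free generators. -/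
abbrev fK (i : ι) : FreeAlgebra ℂ (Gen ι) := FreeAlgebra.ι ℂ (Gen.K i)

/-- The free generators. -/
abbrev fK' (i : ι) : FreeAlgebra ℂ (Gen ι) := FreeAlgebra.ι ℂ (Gen.K' i)

open scoped Classical in
/-- The defining relations of `U_q(𝔤)` in the free algebra on the generators. -/
inductive Rel : FreeAlgebra ℂ (Gen ι) → FreeAlgebra ℂ (Gen ι) → Prop
  | kk' (i : ι) : Rel (fK i * fK' i) 1
  | k'k (i : ι) : Rel (fK' i * fK i) 1
  | comm (i j : ι) : Rel (fK i * fK j) (fK j * fK i)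
  | ke (i j : ι) : Rel (fK i * fE j * fK' i) ((D.qi i ^ D.a i j) • fE j)
  | kf (i j : ι) : Rel (fK i * fF j * fK' i) ((D.qi i ^ (-D.a i j)) • fF j)
  | ef (i j : ι) : Rel (fE i * fF j - fF j * fE i)
      (if i = j then (D.qi i - (D.qi i)⁻¹)⁻¹ • (fK i - fK' i) else 0)
  | serreE (i j : ι) (h : i ≠ j) : Rel (serre (D.qi i) (D.serreDeg i j) (fE i) (fE j)) 0
  | serreF (i j : ι) (h : i ≠ j) : Rel (serre (D.qi i) (D.serreDeg i j) (fF i) (fF j)) 0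

/-- The quantized enveloping algebra `U_q(𝔤)`. -/
def Uq : Type _ := RingQuot D.Rel

instance : Ring D.Uq := inferInstanceAs (Ring (RingQuot D.Rel))

instance : Algebra ℂ D.Uq := inferInstanceAs (Algebra ℂ (RingQuot D.Rel))

/-- The quotient map from the free algebra. -/
def toUq : FreeAlgebra ℂ (Gen ι) →ₐ[ℂ] D.Uq := RingQuot.mkAlgHom ℂ D.Rel

/-- The generator `E_i`. -/
def E (i : ι) : D.Uq := D.toUq (FreeAlgebra.ι ℂ (Gen.E i))

/-- The generator `F_i`. -/
def F (i : ι) : D.Uq := D.toUq (FreeAlgebra.ι ℂ (Gen.F i))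

/-- The generator `K_i`. -/
def K (i : ι) : D.Uq := D.toUq (FreeAlgebra.ι ℂ (Gen.K i))

/-- The generator `K_i⁻¹`. -/
def K' (i : ι) : D.Uq := D.toUq (FreeAlgebra.ι ℂ (Gen.K' i))

theorem toUq_rel {x y : FreeAlgebra ℂ (Gen ι)} (h : D.Rel x y) : D.toUq x = D.toUq y :=
  RingQuot.mkAlgHom_rel ℂ h

theorem relations : D.Relations D.E D.F D.K D.K' where
  kk' i := by simpa [K, K'] using D.toUq_rel (.kk' i)
  k'k i := by simpa [K, K'] using D.toUq_rel (.k'k i)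
  comm i j := by simpa [K] using D.toUq_rel (.comm i j)
  ke i j := by simpa [K, K', E] using D.toUq_rel (.ke i j)
  kf i j := by simpa only [map_mul, map_smul, E, F, K, K'] using D.toUq_rel (.kf i j)
  ef i j := by
    have := D.toUq_rel (.ef i j)
    split_ifs at this ⊢ with h
    · simpa [K, K', E, F] using this
    · simpa [K, K', E, F] using this
  serreE i j h := by simpa [map_serre, E] using D.toUq_rel (.serreE i j h)
  serreF i j h := by simpa [map_serre, F] using D.toUq_rel (.serreF i j h)

variable {D}

/-- The universal property of `U_q(𝔤)`. -/
def lift {R : Type*} [Ring R] [Algebra ℂ R] {e f k k' : ι → R} (h : D.Relations e f k k') :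
    D.Uq →ₐ[ℂ] R :=
  RingQuot.liftAlgHom ℂ ⟨FreeAlgebra.lift ℂ (fun g => match g with
    | .E i => e i
    | .F i => f i
    | .K i => k i
    | .K' i => k' i), by
      intro x y hxy
      cases hxy with
      | kk' i => simpa using h.kk' i
      | k'k i => simpa using h.k'k i
      | comm i j => simpa using h.comm i j
      | ke i j => simpa using h.ke i j
      | kf i j => simpa only [map_mul, map_smul, FreeAlgebra.lift_ι_apply] using h.kf i j
      | ef i j =>
        have := h.ef i j
        split_ifs at this ⊢ with h
        · simpa using this
        · simpa using this
      | serreE i j hij => simpa [map_serre] using h.serreE i j hij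
      | serreF i j hij => simpa [map_serre] using h.serreF i j hij⟩

section lift

variable {R : Type*} [Ring R] [Algebra ℂ R] {e f k k' : ι → R} (h : D.Relations e f k k')

@[simp] theorem lift_E (i : ι) : lift h (D.E i) = e i := by
  exact (RingQuot.liftAlgHom_mkAlgHom_apply ℂ _ _ _).trans (by simp)

@[simp] theorem lift_F (i : ι) : lift h (D.F i) = f i := by
  exact (RingQuot.liftAlgHom_mkAlgHom_apply ℂ _ _ _).trans (by simp)

@[simp] theorem lift_K (i : ι) : lift h (D.K i) = k i := by
  exact (RingQuot.liftAlgHom_mkAlgHom_apply ℂ _ _ _).trans (by simp)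

@[simp] theorem lift_K' (i : ι) : lift h (D.K' i) = k' i := by
  exact (RingQuot.liftAlgHom_mkAlgHom_apply ℂ _ _ _).trans (by simp)

end lift

/-- Algebra maps out of `U_q(𝔤)` are determined by the generators. -/
theorem algHom_ext {R : Type*} [Semiring R] [Algebra ℂ R] {φ ψ : D.Uq →ₐ[ℂ] R}
    (hE : ∀ i, φ (D.E i) = ψ (D.E i)) (hF : ∀ i, φ (D.F i) = ψ (D.F i))
    (hK : ∀ i, φ (D.K i) = ψ (D.K i)) (hK' : ∀ i, φ (D.K' i) = ψ (D.K' i)) : φ = ψ := by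
  have : φ.comp D.toUq = ψ.comp D.toUq := by
    ext g
    cases g with
    | E i => exact hE i
    | F i => exact hF i
    | K i => exact hK i
    | K' i => exact hK' i
  exact RingQuot.ringQuot_ext' ℂ φ ψ this

/-- `U_q(𝔤)` is generated by `E_i`, `F_i`, `K_i`, `K_i⁻¹`. -/
theorem induction_gen {p : D.Uq → Prop} (h1 : p 1) (hE : ∀ i x, p x → p (D.E i * x))
    (hF : ∀ i x, p x → p (D.F i * x)) (hK : ∀ i x, p x → p (D.K i * x))
    (hK' : ∀ i x, p x → p (D.K' i * x)) (hadd : ∀ x y, p x → p y → p (x + y))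
    (hsmul : ∀ (c : ℂ) x, p x → p (c • x)) (x : D.Uq) : p x := by
  obtain ⟨y, rfl⟩ := RingQuot.mkAlgHom_surjective ℂ D.Rel x
  change p (D.toUq y)
  suffices h : ∀ z, p z → p (D.toUq y * z) by simpa using h 1 h1
  induction y using FreeAlgebra.induction with
  | grade0 c =>
    intro z hz
    rw [AlgHom.commutes, ← Algebra.smul_def]
    exact hsmul c z hz
  | grade1 g =>
    intro z hz
    cases g with
    | E i => exact hE i z hz
    | F i => exact hF i z hz
    | K i => exact hK i z hz
    | K' i => exact hK' i z hz
  | mul a b ha hb =>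
    intro z hz
    rw [map_mul, mul_assoc]
    exact ha _ (hb _ hz)
  | add a b ha hb =>
    intro z hz
    rw [map_add, add_mul]
    exact hadd _ _ (ha _ hz) (hb _ hz)

/-! ### Consequences of the relations -/

section

variable {R : Type*} [Ring R] [Algebra ℂ R]

theorem conj_to_comm {x y y' z : R} {c : ℂ} (h : y' * y = 1) (hz : y * x * y' = c • z) :
    y * x = c • (z * y) := by
  rw [← smul_mul_assoc, ← hz, mul_assoc _ y', h, mul_one]

theorem comm_inv {x y y' : R} {c : ℂ} (hc : c ≠ 0) (h : y' * y = 1) (h' : y * y' = 1)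
    (hz : y * x = c • (x * y)) : y' * x = c⁻¹ • (x * y') := by
  have : x * y' = c • (y' * x) := by
    calc x * y' = y' * (y * x) * y' := by rw [← mul_assoc y', h, one_mul]
      _ = c • (y' * x) := by
        rw [hz, mul_smul_comm, smul_mul_assoc, mul_assoc, mul_assoc, h', mul_one]
  rw [this, smul_smul, inv_mul_cancel₀ hc, one_smul]

end

section Relations

variable {R : Type*} [Ring R] [Algebra ℂ R] {e f k k' : ι → R}

namespace Relations

theorem k_e (h : D.Relations e f k k') (i j : ι) :
    k i * e j = (D.qi i ^ D.a i j) • (e j * k i) := conj_to_comm (h.k'k i) (h.ke i j)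

theorem k_f (h : D.Relations e f k k') (i j : ι) :
    k i * f j = (D.qi i ^ (-D.a i j)) • (f j * k i) := conj_to_comm (h.k'k i) (h.kf i j)

theorem k'_e (h : D.Relations e f k k') (i j : ι) :
    k' i * e j = (D.qi i ^ (-D.a i j)) • (e j * k' i) := by
  rw [zpow_neg]
  exact comm_inv (zpow_ne_zero _ (D.qi_ne_zero i)) (h.k'k i) (h.kk' i) (h.k_e i j)

theorem k'_f (h : D.Relations e f k k') (i j : ι) :
    k' i * f j = (D.qi i ^ D.a i j) • (f j * k' i) := by
  have := comm_inv (zpow_ne_zero _ (D.qi_ne_zero i)) (h.k'k i) (h.kk' i) (h.k_f i j)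
  rwa [← zpow_neg, neg_neg] at this

theorem k'_k (h : D.Relations e f k k') (i j : ι) : k' i * k j = k j * k' i := by
  have := comm_inv one_ne_zero (h.k'k i) (h.kk' i)
    (show k i * k j = (1 : ℂ) • (k j * k i) by rw [one_smul, h.comm])
  rwa [inv_one, one_smul] at this

theorem k'_k' (h : D.Relations e f k k') (i j : ι) : k' i * k' j = k' j * k' i := by
  have := comm_inv one_ne_zero (h.k'k i) (h.kk' i)
    (show k i * k' j = (1 : ℂ) • (k' j * k i) by rw [one_smul, h.k'_k])
  rwa [inv_one, one_smul] at this

theorem twE (h : D.Relations e f k k') {i j : ι} (hij : i ≠ j) :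
    serre (D.qi i) (D.serreDeg i j) (e i * k' i) (e j * k' j) = 0 := by
  refine serre_mul_eq_zero (D.qi_generic i) _ _ _ _ _ _ _ (h.k'_k' j i) (h.k'_e i i) (h.k'_e i j)
    ?_ (h.serreE i j hij)
  rw [h.k'_e j i, zpow_neg, zpow_neg, D.qi_symm]

theorem twF (h : D.Relations e f k k') {i j : ι} (hij : i ≠ j) :
    serre (D.qi i) (D.serreDeg i j) (f i * k i) (f j * k j) = 0 := by
  refine serre_mul_eq_zero (D.qi_generic i) _ _ _ _ _ _ _ (h.comm j i) (h.k_f i i) (h.k_f i j)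
    ?_ (h.serreF i j hij)
  rw [h.k_f j i, zpow_neg, zpow_neg, D.qi_symm]

open scoped Classical in
theorem ef_tw (h : D.Relations e f k k') (i j : ι) :
    e i * k' i * (k j * f j) - k j * f j * (e i * k' i) =
      if i = j then (D.qi i - (D.qi i)⁻¹)⁻¹ • (k i - k' i) else 0 := by
  have h1 : e i * k' i * (k j * f j) = k j * (e i * f j) * k' i := by
    have hc := zpow_ne_zero (D.a i j) (D.qi_ne_zero i)
    calc e i * k' i * (k j * f j) = e i * k j * (k' i * f j) := by
          rw [mul_assoc, ← mul_assoc (k' i), h.k'_k]; simp only [mul_assoc]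
      _ = (D.qi i ^ D.a i j) • (e i * k j) * (f j * k' i) := by
          rw [h.k'_f, mul_smul_comm, smul_mul_assoc]
      _ = k j * (e i * f j) * k' i := by
          rw [D.qi_symm, ← h.k_e]; simp only [mul_assoc]
  have h2 : k j * f j * (e i * k' i) = k j * (f j * e i) * k' i := by simp only [mul_assoc]
  rw [h1, h2, ← sub_mul, ← mul_sub, h.ef]
  split_ifs with hij
  · subst hij
    rw [mul_smul_comm, smul_mul_assoc, mul_sub, sub_mul, h.kk', one_mul, mul_assoc, h.kk', mul_one]
  · simp

open scoped Classical in
theorem ef_tw' (h : D.Relations e f k k') (i j : ι) :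
    f j * k j * (k' i * e i) - k' i * e i * (f j * k j) =
      if i = j then (D.qi i - (D.qi i)⁻¹)⁻¹ • (k' i - k i) else 0 := by
  have h1 : f j * k j * (k' i * e i) = k' i * (f j * e i) * k j := by
    calc f j * k j * (k' i * e i) = f j * k' i * (k j * e i) := by
          rw [mul_assoc, ← mul_assoc (k j), ← h.k'_k]; simp only [mul_assoc]
      _ = (D.qi i ^ D.a i j) • (f j * k' i) * (e i * k j) := by
          rw [h.k_e, mul_smul_comm, smul_mul_assoc, D.qi_symm]
      _ = k' i * (f j * e i) * k j := by
          rw [← h.k'_f]; simp only [mul_assoc]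
  have h2 : k' i * e i * (f j * k j) = k' i * (e i * f j) * k j := by simp only [mul_assoc]
  rw [h1, h2, ← sub_mul, ← mul_sub, ← neg_sub (e i * f j), h.ef]
  split_ifs with hij
  · subst hij
    rw [mul_neg, neg_mul, mul_smul_comm, smul_mul_assoc, mul_sub, sub_mul, h.k'k, one_mul,
      mul_assoc, h.k'k, mul_one, ← smul_neg, neg_sub]
  · simp

end Relations

end Relations

/-! ### The Hopf algebra structure -/

open scoped Classical in
theorem comul_relations : D.Relations (R := D.Uq ⊗[ℂ] D.Uq)
    (fun i => D.E i ⊗ₜ D.K i + 1 ⊗ₜ D.E i) (fun i => D.F i ⊗ₜ 1 + D.K' i ⊗ₜ D.F i)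
    (fun i => D.K i ⊗ₜ D.K i) (fun i => D.K' i ⊗ₜ D.K' i) := by
  have h := D.relations
  have tsE (i j : ι) (hij : i ≠ j) (k : D.Uq →ₐ[ℂ] D.Uq ⊗[ℂ] D.Uq) :
      serre (D.qi i) (D.serreDeg i j) (k (D.E i)) (k (D.E j)) = 0 := by
    rw [← map_serre, h.serreE i j hij, map_zero]
  have tsF (i j : ι) (hij : i ≠ j) (k : D.Uq →ₐ[ℂ] D.Uq ⊗[ℂ] D.Uq) :
      serre (D.qi i) (D.serreDeg i j) (k (D.F i)) (k (D.F j)) = 0 := by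
    rw [← map_serre, h.serreF i j hij, map_zero]
  have pow2 (i : ι) : D.qi i ^ D.a i i = D.qi i ^ 2 := by rw [D.a_diag]; norm_cast
  refine ⟨fun i => ?_, fun i => ?_, fun i j => ?_, fun i j => ?_, fun i j => ?_, fun i j => ?_,
    fun i j hij => ?_, fun i j hij => ?_⟩
  · simp [h.kk', Algebra.TensorProduct.one_def]
  · simp [h.k'k, Algebra.TensorProduct.one_def]
  · simp [h.comm i j]
  · simp only [mul_add, add_mul, Algebra.TensorProduct.tmul_mul_tmul, mul_one, h.ke, h.kk', smul_add,
      h.comm i j, TensorProduct.smul_tmul', TensorProduct.tmul_smul]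
    rw [mul_assoc, h.kk', mul_one]
  · simp only [mul_add, add_mul, Algebra.TensorProduct.tmul_mul_tmul, mul_one, h.kf, h.kk', smul_add,
      ← h.k'_k j i, TensorProduct.smul_tmul', TensorProduct.tmul_smul]
    rw [mul_assoc, h.kk', mul_one]
  · simp only [mul_add, add_mul, Algebra.TensorProduct.tmul_mul_tmul, mul_one, one_mul]
    have e1 : (D.K' j * D.E i) ⊗ₜ[ℂ] (D.F j * D.K i) = (D.E i * D.K' j) ⊗ₜ[ℂ] (D.K i * D.F j) := by
      rw [h.k'_e, h.k_f, TensorProduct.tmul_smul, TensorProduct.smul_tmul', zpow_neg, zpow_neg,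
        D.qi_symm]
    have e3 : (D.E i * D.F j - D.F j * D.E i) ⊗ₜ[ℂ] D.K i +
        D.K' j ⊗ₜ[ℂ] (D.E i * D.F j - D.F j * D.E i) =
        if i = j then (D.qi i - (D.qi i)⁻¹)⁻¹ • (D.K i ⊗ₜ[ℂ] D.K i - D.K' i ⊗ₜ[ℂ] D.K' i) else 0 := by
      rw [h.ef]
      split_ifs with hij
      · subst hij
        rw [← TensorProduct.smul_tmul', TensorProduct.tmul_smul, TensorProduct.sub_tmul,
          TensorProduct.tmul_sub, ← smul_add]
        congr 1
        abel
      · simp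
    rw [← e3, TensorProduct.sub_tmul, TensorProduct.tmul_sub]
    rw [e1]
    abel
  · have hz := D.qi_serreDeg hij
    refine serre_coprod (D.qi_generic i) _ _ hz _ _ _ _ ?_ ?_ ?_ ?_ ?_
    · simp only [Algebra.TensorProduct.tmul_mul_tmul, mul_one, one_mul]
      rw [h.k_e j i, TensorProduct.tmul_smul, D.qi_symm]
    · simp only [Algebra.TensorProduct.tmul_mul_tmul, mul_one, one_mul]
      rw [h.k_e i j, TensorProduct.tmul_smul]
    · simp only [Algebra.TensorProduct.tmul_mul_tmul, mul_one, one_mul]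
      rw [h.k_e i i, TensorProduct.tmul_smul, pow2]
    · have := serre_mul_eq_zero (D.qi_generic i) (D.serreDeg i j) 1 1 (D.E i ⊗ₜ[ℂ] (1 : D.Uq))
        ((1 : D.Uq) ⊗ₜ[ℂ] D.K i) (D.E j ⊗ₜ[ℂ] (1 : D.Uq)) ((1 : D.Uq) ⊗ₜ[ℂ] D.K j)
        (by simp [h.comm i j]) (by simp) (by simp) (by simp)
        (tsE i j hij Algebra.TensorProduct.includeLeft)
      simpa using this
    · exact tsE i j hij Algebra.TensorProduct.includeRight
  · have hz := D.qi_serreDeg hij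
    rw [add_comm (D.F i ⊗ₜ[ℂ] (1 : D.Uq)), add_comm (D.F j ⊗ₜ[ℂ] (1 : D.Uq))]
    refine serre_coprod (D.qi_generic i) _ _ hz _ _ _ _ ?_ ?_ ?_ ?_ ?_
    · simp only [Algebra.TensorProduct.tmul_mul_tmul, mul_one, one_mul]
      rw [h.k'_f j i, TensorProduct.smul_tmul', D.qi_symm]
    · simp only [Algebra.TensorProduct.tmul_mul_tmul, mul_one, one_mul]
      rw [h.k'_f i j, TensorProduct.smul_tmul']
    · simp only [Algebra.TensorProduct.tmul_mul_tmul, mul_one, one_mul]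
      rw [h.k'_f i i, TensorProduct.smul_tmul', pow2]
    · have := serre_mul_eq_zero (D.qi_generic i) (D.serreDeg i j) 1 1 ((1 : D.Uq) ⊗ₜ[ℂ] D.F i)
        (D.K' i ⊗ₜ[ℂ] (1 : D.Uq)) ((1 : D.Uq) ⊗ₜ[ℂ] D.F j) (D.K' j ⊗ₜ[ℂ] (1 : D.Uq))
        (by simp [h.k'_k' i j]) (by simp) (by simp) (by simp)
        (tsF i j hij Algebra.TensorProduct.includeRight)
      simpa using this
    · exact tsF i j hij Algebra.TensorProduct.includeLeft

/-- The coproduct. -/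
def comulHom : D.Uq →ₐ[ℂ] D.Uq ⊗[ℂ] D.Uq := lift (comul_relations (D := D))

theorem counit_relations : D.Relations (R := ℂ) (fun _ => 0) (fun _ => 0) (fun _ => 1)
    (fun _ => 1) where
  kk' _ := one_mul 1
  k'k _ := one_mul 1
  comm _ _ := rfl
  ke _ _ := by simp
  kf _ _ := by simp
  ef _ _ := by simp
  serreE _ _ _ := by simp [serre]
  serreF _ _ _ := by simp [serre]

/-- The counit. -/
def counitHom : D.Uq →ₐ[ℂ] ℂ := lift (counit_relations (D := D))

instance : Bialgebra ℂ D.Uq := Bialgebra.ofAlgHom comulHom counitHom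
  (by
    apply algHom_ext <;> intro i <;>
      simp [comulHom, TensorProduct.add_tmul, TensorProduct.tmul_add, add_assoc,
        Algebra.TensorProduct.one_def])
  (by apply algHom_ext <;> intro i <;> simp [comulHom, counitHom])
  (by apply algHom_ext <;> intro i <;> simp [comulHom, counitHom])

theorem antipode_relations : D.Relations (R := D.Uqᵐᵒᵖ)
    (fun i => .op (-(D.E i * D.K' i))) (fun i => .op (-(D.K i * D.F i)))
    (fun i => .op (D.K' i)) (fun i => .op (D.K i)) := by
  have h := D.relations
  refine ⟨fun i => ?_, fun i => ?_, fun i j => ?_, fun i j => ?_, fun i j => ?_, fun i j => ?_,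
    fun i j hij => ?_, fun i j hij => ?_⟩
  · rw [← MulOpposite.op_mul, h.kk', MulOpposite.op_one]
  · rw [← MulOpposite.op_mul, h.k'k, MulOpposite.op_one]
  · rw [← MulOpposite.op_mul, ← MulOpposite.op_mul, h.k'_k']
  · rw [← MulOpposite.op_mul, ← MulOpposite.op_mul, ← MulOpposite.op_smul]
    congr 1
    rw [neg_mul, mul_neg, smul_neg, mul_assoc, h.k'_k', ← mul_assoc, ← mul_assoc, h.ke,
      smul_mul_assoc]
  · rw [← MulOpposite.op_mul, ← MulOpposite.op_mul, ← MulOpposite.op_smul]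
    congr 1
    rw [neg_mul, mul_neg, smul_neg, mul_assoc, ← mul_assoc, h.comm, mul_assoc, ← mul_assoc (D.K i),
      h.kf, mul_smul_comm]
  · rw [← MulOpposite.op_mul, ← MulOpposite.op_mul, ← MulOpposite.op_sub, neg_mul_neg, neg_mul_neg,
      ← neg_sub, h.ef_tw]
    split_ifs with hij
    · rw [← smul_neg, neg_sub, MulOpposite.op_smul, MulOpposite.op_sub]
    · simp
  · rw [serre_op, ← neg_one_smul ℂ (D.E i * _), ← neg_one_smul ℂ (D.E j * _), serre_smul, h.twE hij]
    simp
  · rw [serre_op, h.k_f, h.k_f, ← smul_neg, ← smul_neg, ← neg_one_smul ℂ (D.F i * _),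
      ← neg_one_smul ℂ (D.F j * _), smul_smul, smul_smul, serre_smul, h.twF hij]
    simp

/-- The antipode, as an anti-homomorphism. -/
def antipodeHom : D.Uq →ₐ[ℂ] D.Uqᵐᵒᵖ := lift (antipode_relations (D := D))

theorem antipodeInv_relations : D.Relations (R := D.Uqᵐᵒᵖ)
    (fun i => .op (-(D.K' i * D.E i))) (fun i => .op (-(D.F i * D.K i)))
    (fun i => .op (D.K' i)) (fun i => .op (D.K i)) := by
  have h := D.relations
  refine ⟨fun i => ?_, fun i => ?_, fun i j => ?_, fun i j => ?_, fun i j => ?_, fun i j => ?_,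
    fun i j hij => ?_, fun i j hij => ?_⟩
  · rw [← MulOpposite.op_mul, h.kk', MulOpposite.op_one]
  · rw [← MulOpposite.op_mul, h.k'k, MulOpposite.op_one]
  · rw [← MulOpposite.op_mul, ← MulOpposite.op_mul, h.k'_k']
  · rw [← MulOpposite.op_mul, ← MulOpposite.op_mul, ← MulOpposite.op_smul]
    congr 1
    rw [neg_mul, mul_neg, smul_neg, mul_assoc, ← mul_assoc, ← h.k'_k, mul_assoc,
      ← mul_assoc (D.K i), h.ke, mul_smul_comm]
  · rw [← MulOpposite.op_mul, ← MulOpposite.op_mul, ← MulOpposite.op_smul]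
    congr 1
    rw [neg_mul, mul_neg, smul_neg, mul_assoc, ← h.k'_k, ← mul_assoc, ← mul_assoc, h.kf,
      smul_mul_assoc]
  · rw [← MulOpposite.op_mul, ← MulOpposite.op_mul, ← MulOpposite.op_sub, neg_mul_neg, neg_mul_neg,
      h.ef_tw']
    split_ifs with hij
    · rw [MulOpposite.op_smul, MulOpposite.op_sub]
    · simp
  · rw [serre_op, h.k'_e, h.k'_e, ← smul_neg, ← smul_neg, ← neg_one_smul ℂ (D.E i * _),
      ← neg_one_smul ℂ (D.E j * _), smul_smul, smul_smul, serre_smul, h.twE hij]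
    simp
  · rw [serre_op, ← neg_one_smul ℂ (D.F i * _), ← neg_one_smul ℂ (D.F j * _), serre_smul, h.twF hij]
    simp

/-- The inverse of the antipode, as an anti-homomorphism. -/
def antipodeInvHom : D.Uq →ₐ[ℂ] D.Uqᵐᵒᵖ := lift (antipodeInv_relations (D := D))

/-- The antipode, as a linear map. -/
def antipodeLin : D.Uq →ₗ[ℂ] D.Uq :=
  (MulOpposite.opLinearEquiv ℂ).symm.toLinearMap ∘ₗ antipodeHom.toLinearMap

/-- The inverse of the antipode, as a linear map. -/
def antipodeInvLin : D.Uq →ₗ[ℂ] D.Uq :=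
  (MulOpposite.opLinearEquiv ℂ).symm.toLinearMap ∘ₗ antipodeInvHom.toLinearMap

theorem antipodeLin_mul (x y : D.Uq) :
    antipodeLin (x * y) = antipodeLin y * antipodeLin x := by
  simp [antipodeLin]

theorem antipodeInvLin_mul (x y : D.Uq) :
    antipodeInvLin (x * y) = antipodeInvLin y * antipodeInvLin x := by
  simp [antipodeInvLin]

@[simp] theorem antipodeLin_one : antipodeLin (1 : D.Uq) = 1 := by simp [antipodeLin]

@[simp] theorem antipodeLin_E (i : ι) : antipodeLin (D.E i) = -(D.E i * D.K' i) := by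
  simp [antipodeLin, antipodeHom]

@[simp] theorem antipodeLin_F (i : ι) : antipodeLin (D.F i) = -(D.K i * D.F i) := by
  simp [antipodeLin, antipodeHom]

@[simp] theorem antipodeLin_K (i : ι) : antipodeLin (D.K i) = D.K' i := by
  simp [antipodeLin, antipodeHom]

@[simp] theorem antipodeLin_K' (i : ι) : antipodeLin (D.K' i) = D.K i := by
  simp [antipodeLin, antipodeHom]

@[simp] theorem antipodeInvLin_one : antipodeInvLin (1 : D.Uq) = 1 := by simp [antipodeInvLin]

@[simp] theorem antipodeInvLin_E (i : ι) : antipodeInvLin (D.E i) = -(D.K' i * D.E i) := by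
  simp [antipodeInvLin, antipodeInvHom]

@[simp] theorem antipodeInvLin_F (i : ι) : antipodeInvLin (D.F i) = -(D.F i * D.K i) := by
  simp [antipodeInvLin, antipodeInvHom]

@[simp] theorem antipodeInvLin_K (i : ι) : antipodeInvLin (D.K i) = D.K' i := by
  simp [antipodeInvLin, antipodeInvHom]

@[simp] theorem antipodeInvLin_K' (i : ι) : antipodeInvLin (D.K' i) = D.K i := by
  simp [antipodeInvLin, antipodeInvHom]

theorem antipode_antipodeInv (x : D.Uq) : antipodeLin (antipodeInvLin x) = x := by
  have h := D.relations
  induction x using induction_gen with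
  | h1 => simp
  | hE i x ih =>
    rw [antipodeInvLin_mul, antipodeLin_mul, ih]
    simp [antipodeLin_mul, mul_assoc, h.k'k]
  | hF i x ih =>
    rw [antipodeInvLin_mul, antipodeLin_mul, ih]
    simp [antipodeLin_mul, ← mul_assoc, h.k'k]
  | hK i x ih => rw [antipodeInvLin_mul, antipodeLin_mul, ih]; simp
  | hK' i x ih => rw [antipodeInvLin_mul, antipodeLin_mul, ih]; simp
  | hadd x y hx hy => rw [map_add, map_add, hx, hy]
  | hsmul c x hx => rw [map_smul, map_smul, hx]

theorem antipodeInv_antipode (x : D.Uq) : antipodeInvLin (antipodeLin x) = x := by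
  have h := D.relations
  induction x using induction_gen with
  | h1 => simp
  | hE i x ih =>
    rw [antipodeLin_mul, antipodeInvLin_mul, ih]
    simp [antipodeInvLin_mul, ← mul_assoc, h.kk']
  | hF i x ih =>
    rw [antipodeLin_mul, antipodeInvLin_mul, ih]
    simp [antipodeInvLin_mul, mul_assoc, h.kk']
  | hK i x ih => rw [antipodeLin_mul, antipodeInvLin_mul, ih]; simp
  | hK' i x ih => rw [antipodeLin_mul, antipodeInvLin_mul, ih]; simp
  | hadd x y hx hy => rw [map_add, map_add, hx, hy]
  | hsmul c x hx => rw [map_smul, map_smul, hx]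

theorem comul_eq (x : D.Uq) : Coalgebra.comul (R := ℂ) x = comulHom x := rfl

theorem counit_eq (x : D.Uq) : Coalgebra.counit (R := ℂ) x = counitHom x := rfl

theorem antipode_left (t s : D.Uq ⊗[ℂ] D.Uq) (c : ℂ)
    (ht : LinearMap.mul' ℂ D.Uq (antipodeLin.rTensor D.Uq t) = algebraMap ℂ D.Uq c) :
    LinearMap.mul' ℂ D.Uq (antipodeLin.rTensor D.Uq (t * s)) =
      c • LinearMap.mul' ℂ D.Uq (antipodeLin.rTensor D.Uq s) := by
  induction s using TensorProduct.induction_on with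
  | zero => simp
  | add a b ha hb => simp only [mul_add, map_add, ha, hb, smul_add]
  | tmul a b =>
    have key : LinearMap.mul' ℂ D.Uq (antipodeLin.rTensor D.Uq (t * (a ⊗ₜ b))) =
        antipodeLin a * LinearMap.mul' ℂ D.Uq (antipodeLin.rTensor D.Uq t) * b := by
      clear ht
      induction t using TensorProduct.induction_on with
      | zero => simp
      | add x y hx hy => simp only [add_mul, mul_add, map_add, hx, hy]
      | tmul x y => simp [antipodeLin_mul, mul_assoc]
    rw [key, ht, ← Algebra.commutes, mul_assoc, ← Algebra.smul_def]
    simp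

theorem antipode_right (t s : D.Uq ⊗[ℂ] D.Uq) (c : ℂ)
    (hs : LinearMap.mul' ℂ D.Uq (antipodeLin.lTensor D.Uq s) = algebraMap ℂ D.Uq c) :
    LinearMap.mul' ℂ D.Uq (antipodeLin.lTensor D.Uq (t * s)) =
      c • LinearMap.mul' ℂ D.Uq (antipodeLin.lTensor D.Uq t) := by
  induction t using TensorProduct.induction_on with
  | zero => simp
  | add a b ha hb => simp only [add_mul, map_add, ha, hb, smul_add]
  | tmul a b =>
    have key : LinearMap.mul' ℂ D.Uq (antipodeLin.lTensor D.Uq ((a ⊗ₜ b) * s)) =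
        a * LinearMap.mul' ℂ D.Uq (antipodeLin.lTensor D.Uq s) * antipodeLin b := by
      clear hs
      induction s using TensorProduct.induction_on with
      | zero => simp
      | add x y hx hy => simp only [add_mul, mul_add, map_add, hx, hy]
      | tmul x y => simp [antipodeLin_mul, mul_assoc]
    rw [key, hs, ← Algebra.commutes, mul_assoc, ← Algebra.smul_def]
    simp

theorem antipode_rTensor (x : D.Uq) :
    LinearMap.mul' ℂ D.Uq (antipodeLin.rTensor D.Uq (comulHom x)) =
      algebraMap ℂ D.Uq (counitHom x) := by
  have h := D.relations
  induction x using induction_gen with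
  | h1 => simp [Algebra.TensorProduct.one_def]
  | hE i x ih =>
    rw [map_mul, antipode_left _ _ 0 (by simp [comulHom, mul_assoc, h.k'k])]
    simp [counitHom]
  | hF i x ih =>
    rw [map_mul, antipode_left _ _ 0 (by simp [comulHom])]
    simp [counitHom]
  | hK i x ih =>
    rw [map_mul, antipode_left _ _ 1 (by simp [comulHom, h.k'k]), ih]
    simp [counitHom]
  | hK' i x ih =>
    rw [map_mul, antipode_left _ _ 1 (by simp [comulHom, h.kk']), ih]
    simp [counitHom]
  | hadd x y hx hy => simp only [map_add, hx, hy]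
  | hsmul c x hx => simp only [map_smul, hx, Algebra.algebraMap_eq_smul_one, smul_eq_mul, mul_smul]

theorem antipode_lTensor_gen (g x : D.Uq)
    (hg : LinearMap.mul' ℂ D.Uq (antipodeLin.lTensor D.Uq (comulHom g)) =
      algebraMap ℂ D.Uq (counitHom g))
    (hx : LinearMap.mul' ℂ D.Uq (antipodeLin.lTensor D.Uq (comulHom x)) =
      algebraMap ℂ D.Uq (counitHom x)) :
    LinearMap.mul' ℂ D.Uq (antipodeLin.lTensor D.Uq (comulHom (g * x))) =
      algebraMap ℂ D.Uq (counitHom (g * x)) := by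
  rw [map_mul, antipode_right _ _ _ hx, hg, map_mul, map_mul, ← Algebra.commutes, Algebra.smul_def]

theorem antipode_lTensor (x : D.Uq) :
    LinearMap.mul' ℂ D.Uq (antipodeLin.lTensor D.Uq (comulHom x)) =
      algebraMap ℂ D.Uq (counitHom x) := by
  have h := D.relations
  induction x using induction_gen with
  | h1 => simp [Algebra.TensorProduct.one_def]
  | hE i x ih =>
    exact antipode_lTensor_gen _ _ (by simp [comulHom, counitHom]) ih
  | hF i x ih =>
    exact antipode_lTensor_gen _ _ (by simp [comulHom, counitHom, ← mul_assoc, h.k'k]) ih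
  | hK i x ih => exact antipode_lTensor_gen _ _ (by simp [comulHom, counitHom, h.kk']) ih
  | hK' i x ih => exact antipode_lTensor_gen _ _ (by simp [comulHom, counitHom, h.k'k]) ih
  | hadd x y hx hy => simp only [map_add, hx, hy]
  | hsmul c x hx => simp only [map_smul, hx, Algebra.algebraMap_eq_smul_one, smul_eq_mul, mul_smul]

instance : HopfAlgebra ℂ D.Uq where
  antipode := antipodeLin
  mul_antipode_rTensor_comul := LinearMap.ext antipode_rTensor
  mul_antipode_lTensor_comul := LinearMap.ext antipode_lTensor

/-! ### The `*`-structure of the compact real form -/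

/-- The complex conjugate of a `ℂ`-algebra: the same ring, with `c` acting as its conjugate. -/
def ConjAlg (R : Type*) : Type _ := R

/-- The underlying element of `R`. -/
def ConjAlg.down {R : Type*} (x : ConjAlg R) : R := x

instance (R : Type*) [Ring R] : Ring (ConjAlg R) := inferInstanceAs (Ring R)

instance (R : Type*) [Ring R] [Algebra ℂ R] : Algebra ℂ (ConjAlg R) :=
  ((algebraMap ℂ R).comp (starRingEnd ℂ)).toAlgebra' fun c x =>
    Algebra.commutes (A := R) (starRingEnd ℂ c) x

theorem ConjAlg.smul_def {R : Type*} [Ring R] [Algebra ℂ R] (c : ℂ) (x : R) :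
    (c • (show ConjAlg R from x) : ConjAlg R) = (starRingEnd ℂ c • x : R) :=
  (Algebra.smul_def (A := R) (starRingEnd ℂ c) x).symm

theorem conj_qInt {q : ℂ} (hq : starRingEnd ℂ q = q) (n : ℕ) :
    starRingEnd ℂ (qInt q n) = qInt q n := by
  simp [qInt, hq]

theorem conj_qBinom {q : ℂ} (hq : starRingEnd ℂ q = q) (n k : ℕ) :
    starRingEnd ℂ (qBinom q n k) = qBinom q n k := by
  simp [qBinom, qFact, conj_qInt hq]

theorem ConjAlg.serre_eq {R : Type*} [Ring R] [Algebra ℂ R] {q : ℂ} (hq : starRingEnd ℂ q = q)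
    (m : ℕ) (e x : R) :
    serre q m (show ConjAlg R from e) (show ConjAlg R from x) = (serre q m e x : R) := by
  unfold serre
  refine Finset.sum_congr rfl fun k _ => ?_
  have h := ConjAlg.smul_def ((-1) ^ k * qBinom q m k) (e ^ (m - k) * x * e ^ k)
  rw [map_mul, conj_qBinom hq, map_pow, map_neg, map_one] at h
  exact h

/-- A family satisfying the relations in `R` also satisfies them in the conjugate algebra. -/
theorem Relations.conj {R : Type*} [Ring R] [Algebra ℂ R] {e f k k' : ι → R}
    (h : D.Relations e f k k') : D.Relations (R := ConjAlg R) e f k k' where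
  kk' := h.kk'
  k'k := h.k'k
  comm := h.comm
  ke i j := (h.ke i j).trans (by
    have := ConjAlg.smul_def (D.qi i ^ D.a i j) (e j)
    rw [map_zpow₀, D.conj_qi] at this
    exact this.symm)
  kf i j := (h.kf i j).trans (by
    have := ConjAlg.smul_def (D.qi i ^ (-D.a i j)) (f j)
    rw [map_zpow₀, D.conj_qi] at this
    exact this.symm)
  ef i j := (h.ef i j).trans (by
    split_ifs
    · have := ConjAlg.smul_def ((D.qi i - (D.qi i)⁻¹)⁻¹) (k i - k' i)
      rw [map_inv₀, map_sub, map_inv₀, D.conj_qi] at this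
      exact this.symm
    · rfl)
  serreE i j hij := (ConjAlg.serre_eq (D.conj_qi i) _ _ _).trans (h.serreE i j hij)
  serreF i j hij := (ConjAlg.serre_eq (D.conj_qi i) _ _ _).trans (h.serreF i j hij)

theorem star_relations : D.Relations (R := D.Uqᵐᵒᵖ)
    (fun i => .op (D.K i * D.F i)) (fun i => .op (D.E i * D.K' i))
    (fun i => .op (D.K i)) (fun i => .op (D.K' i)) := by
  have h := D.relations
  have hKc (i : ι) (x : D.Uq) (j : ι) {c : ℂ} (hx : D.K i * x * D.K' i = c • x) (hc : c ≠ 0) :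
      D.K' i * x * D.K i = c⁻¹ • x := by
    have h1 := conj_to_comm (h.k'k i) hx
    have h2 := comm_inv hc (h.k'k i) (h.kk' i) h1
    rw [h2, smul_mul_assoc, mul_assoc, h.k'k, mul_one]
  refine ⟨fun i => ?_, fun i => ?_, fun i j => ?_, fun i j => ?_, fun i j => ?_, fun i j => ?_,
    fun i j hij => ?_, fun i j hij => ?_⟩
  · rw [← MulOpposite.op_mul, h.k'k, MulOpposite.op_one]
  · rw [← MulOpposite.op_mul, h.kk', MulOpposite.op_one]
  · rw [← MulOpposite.op_mul, ← MulOpposite.op_mul, h.comm]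
  · rw [← MulOpposite.op_mul, ← MulOpposite.op_mul, ← MulOpposite.op_smul]
    congr 1
    have hc := zpow_ne_zero (-D.a i j) (D.qi_ne_zero i)
    have := hKc i (D.F j) j (h.kf i j) hc
    rw [zpow_neg, inv_inv] at this
    rw [← mul_assoc (D.K' i), ← mul_assoc (D.K' i), h.k'_k, mul_assoc, mul_assoc, ← mul_assoc (D.K' i), this, mul_smul_comm]
  · rw [← MulOpposite.op_mul, ← MulOpposite.op_mul, ← MulOpposite.op_smul]
    congr 1
    have hc := zpow_ne_zero (D.a i j) (D.qi_ne_zero i)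
    have := hKc i (D.E j) j (h.ke i j) hc
    rw [← zpow_neg] at this
    rw [mul_assoc (D.E j), h.k'_k, ← mul_assoc, ← mul_assoc, this, smul_mul_assoc]
  · rw [← MulOpposite.op_mul, ← MulOpposite.op_mul, ← MulOpposite.op_sub, h.ef_tw]
    by_cases hij : i = j
    · subst hij
      rw [if_pos rfl, if_pos rfl, MulOpposite.op_smul, MulOpposite.op_sub]
    · rw [if_neg hij, if_neg (Ne.symm hij), MulOpposite.op_zero]
  · rw [serre_op, h.k_f, h.k_f, serre_smul, h.twF hij]
    simp
  · rw [serre_op, h.twE hij]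
    simp

/-- The `*`-operation as an algebra map to the conjugate of the opposite algebra. -/
def starHom : D.Uq →ₐ[ℂ] ConjAlg D.Uqᵐᵒᵖ := lift (star_relations (D := D)).conj

/-- The `*`-operation of the compact real form: the conjugate-linear anti-homomorphism with
`K_i* = K_i`, `E_i* = K_i F_i`, `F_i* = E_i K_i⁻¹`. -/
def starU (x : D.Uq) : D.Uq := MulOpposite.unop (starHom x).down

theorem starU_mul (x y : D.Uq) : starU (x * y) = starU y * starU x := by
  unfold starU
  rw [map_mul]
  rfl

theorem starU_add (x y : D.Uq) : starU (x + y) = starU x + starU y := by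
  unfold starU
  rw [map_add]
  rfl

theorem starU_smul (c : ℂ) (x : D.Uq) : starU (c • x) = starRingEnd ℂ c • starU x := by
  unfold starU
  rw [map_smul]
  exact congrArg MulOpposite.unop
    (ConjAlg.smul_def (R := D.Uqᵐᵒᵖ) c (starHom x).down)

@[simp] theorem starU_one : starU (1 : D.Uq) = 1 := by
  unfold starU
  rw [map_one]
  rfl

theorem starU_E (i : ι) : starU (D.E i) = D.K i * D.F i :=
  congrArg (fun y => MulOpposite.unop (ConjAlg.down y)) (lift_E star_relations.conj i)

theorem starU_F (i : ι) : starU (D.F i) = D.E i * D.K' i :=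
  congrArg (fun y => MulOpposite.unop (ConjAlg.down y)) (lift_F star_relations.conj i)

theorem starU_K (i : ι) : starU (D.K i) = D.K i :=
  congrArg (fun y => MulOpposite.unop (ConjAlg.down y)) (lift_K star_relations.conj i)

theorem starU_K' (i : ι) : starU (D.K' i) = D.K' i :=
  congrArg (fun y => MulOpposite.unop (ConjAlg.down y)) (lift_K' star_relations.conj i)

/-- `K_i` as a unit. -/
def unitK (i : ι) : D.Uqˣ := ⟨D.K i, D.K' i, D.relations.kk' i, D.relations.k'k i⟩

theorem unitK_comm (i j : ι) : Commute (D.unitK i) (D.unitK j) :=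
  Units.ext (D.relations.comm i j)

variable (D) in
/-- `K_λ = K_1^{n_1} ⋯ K_r^{n_r}` for `λ = ∑ n_i α_i`. -/
def Klam [Fintype ι] (n : ι → ℤ) : D.Uqˣ :=
  Finset.univ.noncommProd (fun i => D.unitK i ^ n i)
    fun i _ j _ _ => (unitK_comm i j).zpow_zpow (n i) (n j)

/-! ### Representations and the quantized coordinate ring -/

section Rep

variable {V : Type*} [AddCommGroup V] [Module ℂ V]

/-- `v` has weight `μ`, where the integral weight `μ` is given by the integers
`μ i = 2 (μ, α_i) / (α_i, α_i)`, so that `q_i ^ μ_i = q ^ (μ, α_i)`. -/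
def IsWeightVector (π : D.Uq →ₐ[ℂ] Module.End ℂ V) (μ : ι → ℤ) (v : V) : Prop :=
  ∀ i, π (D.K i) v = (D.qi i ^ μ i) • v

/-- The representation is spanned by vectors of integral weight ("type 1"). -/
def IsTypeOne (π : D.Uq →ₐ[ℂ] Module.End ℂ V) : Prop :=
  Submodule.span ℂ {v : V | ∃ μ, IsWeightVector π μ v} = ⊤

/-- Irreducible representations `V(Λ)` of highest weight `Λ`, for a dominant integral weight `Λ`
with coordinates `Λ i = 2 (Λ, α_i) / (α_i, α_i)`. -/
structure IsIrreducibleOfHighestWeight (π : D.Uq →ₐ[ℂ] Module.End ℂ V) (Λ : ι → ℕ) : Prop where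
  irreducible : ∀ W : Submodule ℂ V, (∀ X, ∀ w ∈ W, π X w ∈ W) → W = ⊥ ∨ W = ⊤
  highest : ∃ v : V, v ≠ 0 ∧ (∀ i, π (D.E i) v = 0) ∧ IsWeightVector π (fun i => (Λ i : ℤ)) v

theorem IsWeightVector.k' {π : D.Uq →ₐ[ℂ] Module.End ℂ V} {μ : ι → ℤ} {v : V}
    (h : IsWeightVector π μ v) (i : ι) : π (D.K' i) v = (D.qi i ^ (-μ i)) • v := by
  have h1 : π (D.K' i) (π (D.K i) v) = v := by
    rw [← Module.End.mul_apply, ← map_mul, D.relations.k'k, map_one, Module.End.one_apply]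
  rw [h i, map_smul] at h1
  rw [zpow_neg]
  conv_rhs => rw [← h1]
  rw [smul_smul, inv_mul_cancel₀ (zpow_ne_zero _ (D.qi_ne_zero i)), one_smul]

/-- A highest weight irreducible representation is spanned by its weight vectors. -/
theorem IsIrreducibleOfHighestWeight.isTypeOne {π : D.Uq →ₐ[ℂ] Module.End ℂ V} {Λ : ι → ℕ}
    (h : IsIrreducibleOfHighestWeight π Λ) : IsTypeOne π := by
  have hr := D.relations
  have key : ∀ X : D.Uq, ∀ w ∈ Submodule.span ℂ {v : V | ∃ μ, IsWeightVector π μ v},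
      π X w ∈ Submodule.span ℂ {v : V | ∃ μ, IsWeightVector π μ v} := by
    have gen : ∀ g : D.Uq, (∀ v μ, IsWeightVector π μ v → ∃ μ', IsWeightVector π μ' (π g v)) →
        ∀ w ∈ Submodule.span ℂ {v : V | ∃ μ, IsWeightVector π μ v},
          π g w ∈ Submodule.span ℂ {v : V | ∃ μ, IsWeightVector π μ v} := by
      intro g hg w hw
      induction hw using Submodule.span_induction with
      | mem x hx =>
        obtain ⟨μ, hμ⟩ := hx
        exact Submodule.subset_span (hg x μ hμ)
      | zero => simp
      | add x y _ _ hx hy => rw [map_add]; exact add_mem hx hy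
      | smul c x _ hx => rw [map_smul]; exact Submodule.smul_mem _ _ hx
    have shift : ∀ (g : D.Uq) (ν : ι → ℤ), (∀ i, D.K i * g = (D.qi i ^ ν i) • (g * D.K i)) →
        ∀ v μ, IsWeightVector π μ v → ∃ μ', IsWeightVector π μ' (π g v) := by
      intro g ν hν v μ hv
      refine ⟨fun i => ν i + μ i, fun i => ?_⟩
      rw [← Module.End.mul_apply, ← map_mul, hν i, map_smul, map_mul, LinearMap.smul_apply,
        Module.End.mul_apply, hv i, map_smul, smul_smul, zpow_add₀ (D.qi_ne_zero i)]
    intro X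
    induction X using induction_gen with
    | h1 => intro w hw; simpa using hw
    | hE i x ih =>
      intro w hw
      rw [map_mul, Module.End.mul_apply]
      exact gen _ (shift _ (fun j => D.a j i) fun j => hr.k_e j i) _ (ih w hw)
    | hF i x ih =>
      intro w hw
      rw [map_mul, Module.End.mul_apply]
      exact gen _ (shift _ (fun j => -D.a j i) fun j => hr.k_f j i) _ (ih w hw)
    | hK i x ih =>
      intro w hw
      rw [map_mul, Module.End.mul_apply]
      exact gen _ (shift _ (fun _ => 0) fun j => by rw [zpow_zero, one_smul, hr.comm]) _ (ih w hw)
    | hK' i x ih =>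
      intro w hw
      rw [map_mul, Module.End.mul_apply]
      exact gen _ (shift _ (fun _ => 0) fun j => by rw [zpow_zero, one_smul, hr.k'_k]) _ (ih w hw)
    | hadd x y hx hy =>
      intro w hw
      rw [map_add, LinearMap.add_apply]
      exact add_mem (hx w hw) (hy w hw)
    | hsmul c x hx =>
      intro w hw
      rw [map_smul, LinearMap.smul_apply]
      exact Submodule.smul_mem _ _ (hx w hw)
  refine (h.irreducible _ key).resolve_left fun hbot => ?_
  obtain ⟨v, hv0, -, hv⟩ := h.highest
  have : v ∈ Submodule.span ℂ {v : V | ∃ μ, IsWeightVector π μ v} :=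
    Submodule.subset_span ⟨_, hv⟩
  rw [hbot, Submodule.mem_bot] at this
  exact hv0 this

/-- The matrix coefficient `c_{f,v}(X) = f(X ▷ v)`. Linear functionals on `U_q(𝔤)` carry the
convolution product `(φ ψ)(X) = (φ ⊗ ψ)(Δ(X))`. -/
def coeff (π : D.Uq →ₐ[ℂ] Module.End ℂ V) (f : Module.Dual ℂ V) (v : V) :
    WithConv (D.Uq →ₗ[ℂ] ℂ) :=
  WithConv.toConv (f ∘ₗ π.toLinearMap.flip v)

@[simp] theorem coeff_apply (π : D.Uq →ₐ[ℂ] Module.End ℂ V) (f : Module.Dual ℂ V) (v : V)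
    (X : D.Uq) : coeff π f v X = f (π X v) := rfl

end Rep

variable (D) in
/-- The span of the matrix coefficients of finite-dimensional (type 1) representations. -/
def coeffSpan : Submodule ℂ (WithConv (D.Uq →ₗ[ℂ] ℂ)) :=
  Submodule.span ℂ {φ | ∃ (n : ℕ) (π : D.Uq →ₐ[ℂ] Module.End ℂ (Fin n → ℂ)), IsTypeOne π ∧
    ∃ (f : Module.Dual ℂ (Fin n → ℂ)) (v : Fin n → ℂ), φ = coeff π f v}

theorem coeff_mem {V : Type*} [AddCommGroup V] [Module ℂ V] [FiniteDimensional ℂ V]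
    {π : D.Uq →ₐ[ℂ] Module.End ℂ V} (hπ : IsTypeOne π) (f : Module.Dual ℂ V) (v : V) :
    coeff π f v ∈ D.coeffSpan := by
  let e : V ≃ₗ[ℂ] (Fin (Module.finrank ℂ V) → ℂ) := (Module.finBasis ℂ V).equivFun
  refine Submodule.subset_span ⟨_, (LinearEquiv.conjAlgEquiv ℂ e).toAlgHom.comp π, ?_,
    f ∘ₗ e.symm.toLinearMap, e v, ?_⟩
  · unfold IsTypeOne at hπ ⊢
    rw [eq_top_iff] at hπ ⊢
    intro w _
    have h1 : e.symm w ∈ Submodule.span ℂ {v : V | ∃ μ, IsWeightVector π μ v} := hπ trivial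
    have h2 := Submodule.mem_map_of_mem (f := e.toLinearMap) h1
    rw [Submodule.map_span] at h2
    have h3 : e.toLinearMap (e.symm w) = w := e.apply_symm_apply w
    rw [h3] at h2
    refine Submodule.span_mono ?_ h2
    rintro _ ⟨x, ⟨μ, hμ⟩, rfl⟩
    refine ⟨μ, fun i => ?_⟩
    simp [LinearEquiv.conjAlgEquiv_apply, hμ i]
  · ext X
    simp [LinearEquiv.conjAlgEquiv_apply]

theorem one_mem_coeffSpan : (1 : WithConv (D.Uq →ₗ[ℂ] ℂ)) ∈ D.coeffSpan := by
  have h : IsTypeOne ((Algebra.ofId ℂ (Module.End ℂ ℂ)).comp (counitHom (D := D))) := by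
    unfold IsTypeOne
    rw [eq_top_iff]
    intro w _
    refine Submodule.subset_span ⟨fun _ => 0, fun i => ?_⟩
    simp [counitHom]
  have := coeff_mem h LinearMap.id 1
  convert this using 1
  ext X
  simp [counit_eq, Algebra.ofId_apply]

/-- The tensor product of two representations. -/
def tensorRep {V W : Type*} [AddCommGroup V] [Module ℂ V] [AddCommGroup W] [Module ℂ W]
    (π : D.Uq →ₐ[ℂ] Module.End ℂ V) (σ : D.Uq →ₐ[ℂ] Module.End ℂ W) :
    D.Uq →ₐ[ℂ] Module.End ℂ (V ⊗[ℂ] W) :=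
  ((Module.endTensorEndAlgHom (R := ℂ) (A := ℂ) (M := V) (N := W)).comp
    (Algebra.TensorProduct.map π σ)).comp comulHom

theorem mul_mem_coeffSpan (φ ψ : WithConv (D.Uq →ₗ[ℂ] ℂ)) (hφ : φ ∈ D.coeffSpan)
    (hψ : ψ ∈ D.coeffSpan) : φ * ψ ∈ D.coeffSpan := by
  have h : φ * ψ ∈ D.coeffSpan * D.coeffSpan := Submodule.mul_mem_mul hφ hψ
  rw [coeffSpan, Submodule.span_mul_span] at h
  refine Submodule.span_le.2 ?_ h
  rintro _ ⟨_, ⟨n, π, hπ, f, v, rfl⟩, _, ⟨m, σ, hσ, g, w, rfl⟩, rfl⟩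
  have hT : IsTypeOne (tensorRep π σ) := by
    unfold IsTypeOne at hπ hσ ⊢
    rw [eq_top_iff, ← TensorProduct.map₂_mk_top_top_eq_top, ← hπ, ← hσ, Submodule.map₂_span_span]
    refine Submodule.span_mono ?_
    rintro _ ⟨x, ⟨μ, hμ⟩, y, ⟨ν, hν⟩, rfl⟩
    refine ⟨fun i => μ i + ν i, fun i => ?_⟩
    have h1 : tensorRep π σ (D.K i) (x ⊗ₜ y) = (π (D.K i) x) ⊗ₜ (σ (D.K i) y) := by
      simp [tensorRep, comulHom, Module.endTensorEndAlgHom_apply]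
    change tensorRep π σ (D.K i) (x ⊗ₜ y) = _ • (x ⊗ₜ y)
    rw [h1, hμ i, hν i, zpow_add₀ (D.qi_ne_zero i), TensorProduct.smul_tmul_smul]
  have := coeff_mem hT (LinearMap.mul' ℂ ℂ ∘ₗ TensorProduct.map f g) (v ⊗ₜ w)
  suffices he : coeff π f v * coeff σ g w = coeff (tensorRep π σ)
      (LinearMap.mul' ℂ ℂ ∘ₗ TensorProduct.map f g) (v ⊗ₜ w) by
    rw [← he] at this
    exact this
  ext X
  simp only [LinearMap.convMul_apply, coeff_apply, comul_eq, tensorRep, AlgHom.comp_apply]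
  generalize comulHom X = t
  induction t using TensorProduct.induction_on with
  | zero => simp
  | add a b ha hb => simp only [map_add, LinearMap.add_apply, ha, hb]
  | tmul a b => simp [Module.endTensorEndAlgHom_apply]

variable (D) in
/-- The quantized coordinate ring `ℂ_q[G]`. -/
def CqG : Subalgebra ℂ (WithConv (D.Uq →ₗ[ℂ] ℂ)) :=
  D.coeffSpan.toSubalgebra one_mem_coeffSpan mul_mem_coeffSpan

theorem mem_CqG {φ : WithConv (D.Uq →ₗ[ℂ] ℂ)} : φ ∈ D.CqG ↔ φ ∈ D.coeffSpan := Iff.rfl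

/-- To show that an additive, (conjugate-)homogeneous operation preserves `ℂ_q[G]` it is enough to
look at matrix coefficients. -/
theorem CqG_induction {p : WithConv (D.Uq →ₗ[ℂ] ℂ) → Prop}
    (hc : ∀ (n : ℕ) (π : D.Uq →ₐ[ℂ] Module.End ℂ (Fin n → ℂ)), IsTypeOne π →
      ∀ f v, p (coeff π f v))
    (h0 : p 0) (hadd : ∀ x y, p x → p y → p (x + y)) (hsmul : ∀ (c : ℂ) x, p x → p (c • x))
    (φ : WithConv (D.Uq →ₗ[ℂ] ℂ)) (h : φ ∈ D.CqG) : p φ := by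
  rw [mem_CqG, coeffSpan] at h
  induction h using Submodule.span_induction with
  | mem x hx =>
    obtain ⟨n, π, hπ, f, v, rfl⟩ := hx
    exact hc n π hπ f v
  | zero => exact h0
  | add x y _ _ hx hy => exact hadd x y hx hy
  | smul c x _ hx => exact hsmul c x hx

/-- `φ ◁ X`, i.e. `(φ ◁ X)(Y) = φ(XY)`. -/
def rightActDual : D.Uq →ₗ[ℂ] WithConv (D.Uq →ₗ[ℂ] ℂ) →ₗ[ℂ] WithConv (D.Uq →ₗ[ℂ] ℂ) :=
  LinearMap.mk₂ ℂ (fun X φ => WithConv.toConv (φ.ofConv ∘ₗ LinearMap.mulLeft ℂ X))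
    (fun _ _ _ => by ext; simp [add_mul]) (fun _ _ _ => by ext; simp)
    (fun _ _ _ => by ext; simp) (fun _ _ _ => by ext; simp)

/-- `X ▷ φ`, i.e. `(X ▷ φ)(Y) = φ(YX)`. -/
def leftActDual : D.Uq →ₗ[ℂ] WithConv (D.Uq →ₗ[ℂ] ℂ) →ₗ[ℂ] WithConv (D.Uq →ₗ[ℂ] ℂ) :=
  LinearMap.mk₂ ℂ (fun X φ => WithConv.toConv (φ.ofConv ∘ₗ LinearMap.mulRight ℂ X))
    (fun _ _ _ => by ext; simp [mul_add]) (fun _ _ _ => by ext; simp)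
    (fun _ _ _ => by ext; simp) (fun _ _ _ => by ext; simp)

@[simp] theorem rightActDual_apply (X : D.Uq) (φ : WithConv (D.Uq →ₗ[ℂ] ℂ)) (Y : D.Uq) :
    rightActDual X φ Y = φ (X * Y) := rfl

@[simp] theorem leftActDual_apply (X : D.Uq) (φ : WithConv (D.Uq →ₗ[ℂ] ℂ)) (Y : D.Uq) :
    leftActDual X φ Y = φ (Y * X) := rfl

/-- `φ*(X) = conj (φ(S(X)*))`. -/
def starDual (φ : WithConv (D.Uq →ₗ[ℂ] ℂ)) : WithConv (D.Uq →ₗ[ℂ] ℂ) :=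
  WithConv.toConv
    { toFun := fun X => starRingEnd ℂ (φ (starU (HopfAlgebra.antipode ℂ X)))
      map_add' := fun x y => by rw [map_add, starU_add, map_add, map_add]
      map_smul' := fun c x => by
        rw [map_smul, starU_smul, map_smul, smul_eq_mul, map_mul, Complex.conj_conj]; rfl }

@[simp] theorem starDual_apply (φ : WithConv (D.Uq →ₗ[ℂ] ℂ)) (X : D.Uq) :
    starDual φ X = starRingEnd ℂ (φ (starU (HopfAlgebra.antipode ℂ X))) := rfl

theorem antipode_eq : HopfAlgebra.antipode ℂ (A := D.Uq) = antipodeLin := rfl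

theorem rightActDual_mem (X : D.Uq) (φ : WithConv (D.Uq →ₗ[ℂ] ℂ)) (h : φ ∈ D.CqG) :
    rightActDual X φ ∈ D.CqG := by
  refine CqG_induction (p := fun φ => rightActDual X φ ∈ D.CqG) ?_ ?_ ?_ ?_ φ h
  · intro n π hπ f v
    have : rightActDual X (coeff π f v) = coeff π (f ∘ₗ π X) v := by ext Y; simp
    rw [this]
    exact coeff_mem hπ _ _
  · rw [map_zero]; exact zero_mem _
  · intro x y hx hy; rw [map_add]; exact add_mem hx hy
  · intro c x hx; rw [map_smul]; exact D.CqG.smul_mem hx c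

theorem leftActDual_mem (X : D.Uq) (φ : WithConv (D.Uq →ₗ[ℂ] ℂ)) (h : φ ∈ D.CqG) :
    leftActDual X φ ∈ D.CqG := by
  refine CqG_induction (p := fun φ => leftActDual X φ ∈ D.CqG) ?_ ?_ ?_ ?_ φ h
  · intro n π hπ f v
    have : leftActDual X (coeff π f v) = coeff π f (π X v) := by ext Y; simp
    rw [this]
    exact coeff_mem hπ _ _
  · rw [map_zero]; exact zero_mem _
  · intro x y hx hy; rw [map_add]; exact add_mem hx hy
  · intro c x hx; rw [map_smul]; exact D.CqG.smul_mem hx c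

/-- The representation `X ↦ conj ∘ π(S(X)*) ∘ conj` on `ℂⁿ`. -/
def conjRep {n : ℕ} (π : D.Uq →ₐ[ℂ] Module.End ℂ (Fin n → ℂ)) :
    D.Uq →ₐ[ℂ] Module.End ℂ (Fin n → ℂ) :=
  AlgHom.ofLinearMap
    { toFun := fun X =>
        { toFun := fun v => star (π (starU (antipodeLin X)) (star v))
          map_add' := fun v w => by rw [star_add, map_add, star_add]
          map_smul' := fun c v => by rw [star_smul, map_smul, star_smul, star_star]; rfl }
      map_add' := fun X Y => by
        refine LinearMap.ext fun v => ?_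
        simp [starU_add]
      map_smul' := fun c X => by
        refine LinearMap.ext fun v => ?_
        simp [starU_smul] }
    (LinearMap.ext fun v => by simp)
    (fun X Y => LinearMap.ext fun v => by simp [antipodeLin_mul, starU_mul])

theorem conjRep_apply {n : ℕ} (π : D.Uq →ₐ[ℂ] Module.End ℂ (Fin n → ℂ)) (X : D.Uq)
    (v : Fin n → ℂ) : conjRep π X v = star (π (starU (antipodeLin X)) (star v)) := rfl

theorem starDual_mem (φ : WithConv (D.Uq →ₗ[ℂ] ℂ)) (h : φ ∈ D.CqG) : starDual φ ∈ D.CqG := by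
  refine CqG_induction (p := fun φ => starDual φ ∈ D.CqG) ?_ ?_ ?_ ?_ φ h
  · intro n π hπ f v
    let g : Module.Dual ℂ (Fin n → ℂ) :=
      { toFun := fun w => starRingEnd ℂ (f (star w))
        map_add' := fun v w => by rw [star_add, map_add, map_add]
        map_smul' := fun c v => by rw [star_smul, map_smul, smul_eq_mul, map_mul]; simp }
    have : starDual (coeff π f v) = coeff (conjRep π) g (star v) := by
      ext X
      simp [conjRep_apply, g, antipode_eq]
    rw [this]
    refine coeff_mem ?_ _ _
    unfold IsTypeOne at hπ ⊢
    rw [eq_top_iff] at hπ ⊢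
    intro w _
    have hw : star w ∈ Submodule.span ℂ {v | ∃ μ, IsWeightVector π μ v} := hπ trivial
    rw [← star_star w]
    clear hπ
    generalize star w = u at hw
    induction hw using Submodule.span_induction with
    | mem x hx =>
      obtain ⟨μ, hμ⟩ := hx
      refine Submodule.subset_span ⟨fun i => -μ i, fun i => ?_⟩
      rw [conjRep_apply, antipodeLin_K, starU_K', star_star, hμ.k', star_smul]
      congr 1
      exact (map_zpow₀ (starRingEnd ℂ) _ _).trans (by rw [D.conj_qi])
    | zero => rw [star_zero]; exact zero_mem _
    | add x y _ _ hx hy => rw [star_add]; exact add_mem (hx) (hy)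
    | smul c x _ hx => rw [star_smul]; exact Submodule.smul_mem _ _ (hx)
  · have : starDual (0 : WithConv (D.Uq →ₗ[ℂ] ℂ)) = 0 := by ext X; simp
    rw [this]; exact zero_mem _
  · intro x y hx hy
    have : starDual (x + y) = starDual x + starDual y := by ext X; simp
    rw [this]; exact add_mem hx hy
  · intro c x hx
    have : starDual (c • x) = starRingEnd ℂ c • starDual x := by ext X; simp
    rw [this]; exact D.CqG.smul_mem hx _

/-- The `*`-operation of `ℂ_q[G]`. -/
def CqG.star (φ : D.CqG) : D.CqG := ⟨starDual φ.1, starDual_mem φ.1 φ.2⟩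

end Datum

/-! ### Module algebras, invariant matrices and equivariant `K₀` -/

/-- The (linear) inverse of the antipode of a Hopf algebra with bijective antipode. -/
class AntipodeInverse (U : Type*) [Ring U] [HopfAlgebra ℂ U] where
  inv : U →ₗ[ℂ] U
  antipode_inv : ∀ X, HopfAlgebra.antipode ℂ (inv X) = X
  inv_antipode : ∀ X, inv (HopfAlgebra.antipode ℂ X) = X

instance {ι : Type*} (D : Datum ι) : AntipodeInverse D.Uq where
  inv := Datum.antipodeInvLin
  antipode_inv := Datum.antipode_antipodeInv
  inv_antipode := Datum.antipodeInv_antipode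

/-- A right `U`-module algebra structure on `B`; `act X b` is `b ◁ X`. -/
structure RightModuleAlgebra (U B : Type*) [Ring U] [HopfAlgebra ℂ U] [Ring B] [Algebra ℂ B] where
  act : U →ₗ[ℂ] B →ₗ[ℂ] B
  act_one : ∀ b, act 1 b = b
  act_mul : ∀ X Y b, act (X * Y) b = act Y (act X b)
  /-- `1 ◁ X = ε(X) 1`. -/
  act_unit : ∀ X, act X 1 = Coalgebra.counit (R := ℂ) X • 1
  /-- `(a b) ◁ X = (a ◁ X₍₁₎) (b ◁ X₍₂₎)`. -/
  act_prod : ∀ X a b, act X (a * b) =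
    LinearMap.mul' ℂ B (TensorProduct.map (act.flip a) (act.flip b) (Coalgebra.comul (R := ℂ) X))

/-- A left `U`-module algebra structure on `B`; `act X b` is `X ▷ b`. -/
structure LeftModuleAlgebra (U B : Type*) [Ring U] [HopfAlgebra ℂ U] [Ring B] [Algebra ℂ B] where
  act : U →ₗ[ℂ] B →ₗ[ℂ] B
  act_one : ∀ b, act 1 b = b
  act_mul : ∀ X Y b, act (X * Y) b = act X (act Y b)
  /-- `X ▷ 1 = ε(X) 1`. -/
  act_unit : ∀ X, act X 1 = Coalgebra.counit (R := ℂ) X • 1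
  /-- `X ▷ (a b) = (X₍₁₎ ▷ a) (X₍₂₎ ▷ b)`. -/
  act_prod : ∀ X a b, act X (a * b) =
    LinearMap.mul' ℂ B (TensorProduct.map (act.flip a) (act.flip b) (Coalgebra.comul (R := ℂ) X))

section Invariant

variable {U B : Type*} [Ring U] [HopfAlgebra ℂ U] [Ring B] [Algebra ℂ B]
variable {l m n p : Type*} [Fintype l] [Fintype m] [Fintype n] [Fintype p]

/-- Matrix multiplication as a bilinear map. -/
def matMul : Matrix l m B →ₗ[ℂ] Matrix m n B →ₗ[ℂ] Matrix l n B :=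
  LinearMap.mk₂ ℂ (fun M N => M * N) (fun _ _ _ => Matrix.add_mul _ _ _)
    (fun _ _ _ => Matrix.smul_mul _ _ _) (fun _ _ _ => Matrix.mul_add _ _ _)
    (fun _ _ _ => Matrix.mul_smul _ _ _)

/-- `X ↦ f(X₍₁₎) g(X₍₂₎)` for matrix-valued `f` and `g`. -/
def matConv (f : U →ₗ[ℂ] Matrix l m B) (g : U →ₗ[ℂ] Matrix m n B) : U →ₗ[ℂ] Matrix l n B :=
  TensorProduct.lift (matMul.compl₁₂ f g) ∘ₗ Coalgebra.comul

/-- A scalar matrix-valued map, regarded as taking values in matrices over `B`. -/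
def scalarMat (B : Type*) [Ring B] [Algebra ℂ B] (ρ : U →ₗ[ℂ] Matrix l m ℂ) :
    U →ₗ[ℂ] Matrix l m B :=
  (Algebra.linearMap ℂ B).mapMatrix ∘ₗ ρ

/-- Entrywise action: `X ↦ T(X)(M)`. -/
def entrywise (T : U →ₗ[ℂ] B →ₗ[ℂ] B) (M : Matrix l m B) : U →ₗ[ℂ] Matrix l m B where
  toFun X := M.map (T X)
  map_add' X Y := by ext; simp
  map_smul' c X := by ext; simp

/-- An anti-representation `ρ°` of `U`, i.e. a representation of the opposite algebra, as a linear
map on `U`. -/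
def antiRep {N : ℕ} (ρ : Uᵐᵒᵖ →ₐ[ℂ] Matrix (Fin N) (Fin N) ℂ) :
    U →ₗ[ℂ] Matrix (Fin N) (Fin N) ℂ :=
  ρ.toLinearMap ∘ₗ (MulOpposite.opLinearEquiv ℂ).toLinearMap

variable [AntipodeInverse U] {N K : ℕ}

/-- `ad°_L(X)(M) = ρ°(X₍₁₎) (M ◁ X₍₂₎) σ°(S⁻¹(X₍₃₎))`; for square matrices one takes `σ = ρ`. -/
def adL (A : RightModuleAlgebra U B) (ρ : Uᵐᵒᵖ →ₐ[ℂ] Matrix (Fin N) (Fin N) ℂ)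
    (σ : Uᵐᵒᵖ →ₐ[ℂ] Matrix (Fin K) (Fin K) ℂ) (M : Matrix (Fin N) (Fin K) B) :
    U →ₗ[ℂ] Matrix (Fin N) (Fin K) B :=
  matConv (matConv (scalarMat B (antiRep ρ)) (entrywise A.act M))
    (scalarMat B (antiRep σ ∘ₗ AntipodeInverse.inv))

/-- `ad°_R(X)(M) = ρ°(S⁻¹(X₍₁₎)) (S⁻²(X₍₂₎) ▷ M) σ°(X₍₃₎)`; for square matrices one takes
`σ = ρ`. -/
def adR (A : LeftModuleAlgebra U B) (ρ : Uᵐᵒᵖ →ₐ[ℂ] Matrix (Fin N) (Fin N) ℂ)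
    (σ : Uᵐᵒᵖ →ₐ[ℂ] Matrix (Fin K) (Fin K) ℂ) (M : Matrix (Fin N) (Fin K) B) :
    U →ₗ[ℂ] Matrix (Fin N) (Fin K) B :=
  matConv (matConv (scalarMat B (antiRep ρ ∘ₗ AntipodeInverse.inv)) (entrywise (A.act ∘ₗ AntipodeInverse.inv ∘ₗ AntipodeInverse.inv) M))
    (scalarMat B (antiRep σ))

/-- Right `U`-invariance of a matrix, with respect to `ρ°` on rows and `σ°` on columns. -/
def IsRightInvariant (A : RightModuleAlgebra U B) (ρ : Uᵐᵒᵖ →ₐ[ℂ] Matrix (Fin N) (Fin N) ℂ)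
    (σ : Uᵐᵒᵖ →ₐ[ℂ] Matrix (Fin K) (Fin K) ℂ) (M : Matrix (Fin N) (Fin K) B) : Prop :=
  ∀ X : U, adL A ρ σ M X = Coalgebra.counit (R := ℂ) X • M

/-- Left `U`-invariance of a matrix, with respect to `ρ°` on rows and `σ°` on columns. -/
def IsLeftInvariant (A : LeftModuleAlgebra U B) (ρ : Uᵐᵒᵖ →ₐ[ℂ] Matrix (Fin N) (Fin N) ℂ)
    (σ : Uᵐᵒᵖ →ₐ[ℂ] Matrix (Fin K) (Fin K) ℂ) (M : Matrix (Fin N) (Fin K) B) : Prop :=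
  ∀ X : U, adR A ρ σ M X = Coalgebra.counit (R := ℂ) X • M

/-- A right `U`-invariant projection (idempotent matrix) over `B`, with its anti-representation. -/
structure RightInvariantProjection (A : RightModuleAlgebra U B) where
  size : ℕ
  rep : Uᵐᵒᵖ →ₐ[ℂ] Matrix (Fin size) (Fin size) ℂ
  mat : Matrix (Fin size) (Fin size) B
  idempotent : IsIdempotentElem mat
  invariant : IsRightInvariant A rep rep mat

/-- A left `U`-invariant projection (idempotent matrix) over `B`, with its anti-representation. -/
structure LeftInvariantProjection (A : LeftModuleAlgebra U B) where
  size : ℕ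
  rep : Uᵐᵒᵖ →ₐ[ℂ] Matrix (Fin size) (Fin size) ℂ
  mat : Matrix (Fin size) (Fin size) B
  idempotent : IsIdempotentElem mat
  invariant : IsLeftInvariant A rep rep mat

/-- Invariant Murray-von Neumann equivalence. -/
def RightInvariantProjection.Equiv {A : RightModuleAlgebra U B}
    (P Q : RightInvariantProjection A) : Prop :=
  ∃ (x : Matrix (Fin P.size) (Fin Q.size) B) (y : Matrix (Fin Q.size) (Fin P.size) B),
    IsRightInvariant A P.rep Q.rep x ∧ IsRightInvariant A Q.rep P.rep y ∧
      x * y = P.mat ∧ y * x = Q.mat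

/-- Invariant Murray-von Neumann equivalence. -/
def LeftInvariantProjection.Equiv {A : LeftModuleAlgebra U B}
    (P Q : LeftInvariantProjection A) : Prop :=
  ∃ (x : Matrix (Fin P.size) (Fin Q.size) B) (y : Matrix (Fin Q.size) (Fin P.size) B),
    IsLeftInvariant A P.rep Q.rep x ∧ IsLeftInvariant A Q.rep P.rep y ∧
      x * y = P.mat ∧ y * x = Q.mat

/-- `T` is the block diagonal sum `P ⊕ Q`, with block diagonal anti-representation. -/
def RightInvariantProjection.IsDirectSum {A : RightModuleAlgebra U B}
    (T P Q : RightInvariantProjection A) : Prop :=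
  ∃ e : Fin P.size ⊕ Fin Q.size ≃ Fin T.size,
    T.mat.submatrix e e = Matrix.fromBlocks P.mat 0 0 Q.mat ∧
      ∀ X, (T.rep X).submatrix e e = Matrix.fromBlocks (P.rep X) 0 0 (Q.rep X)

/-- `T` is the block diagonal sum `P ⊕ Q`, with block diagonal anti-representation. -/
def LeftInvariantProjection.IsDirectSum {A : LeftModuleAlgebra U B}
    (T P Q : LeftInvariantProjection A) : Prop :=
  ∃ e : Fin P.size ⊕ Fin Q.size ≃ Fin T.size,
    T.mat.submatrix e e = Matrix.fromBlocks P.mat 0 0 Q.mat ∧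
      ∀ X, (T.rep X).submatrix e e = Matrix.fromBlocks (P.rep X) 0 0 (Q.rep X)

/-- The equivariant `K₀`-group `ᵁK₀(B)` of a right `U`-module algebra: the Grothendieck group of
equivalence classes of right invariant projections under direct sum. It is presented by one
generator `[P]` for each projection and the relations `[P] = [Q]` for equivalent projections and
`[P ⊕ Q] = [P] + [Q]`. -/
def RightK0 (A : RightModuleAlgebra U B) : Type _ :=
  FreeAbelianGroup (RightInvariantProjection A) ⧸ AddSubgroup.closure
    ({x | ∃ P Q : RightInvariantProjection A, P.Equiv Q ∧ x = .of P - .of Q} ∪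
      {x | ∃ T P Q : RightInvariantProjection A, T.IsDirectSum P Q ∧ x = .of T - (.of P + .of Q)})

/-- The equivariant `K₀`-group `K₀(B)ᵁ` of a left `U`-module algebra: the Grothendieck group of
equivalence classes of left invariant projections under direct sum, presented as in the right
case. -/
def LeftK0 (A : LeftModuleAlgebra U B) : Type _ :=
  FreeAbelianGroup (LeftInvariantProjection A) ⧸ AddSubgroup.closure
    ({x | ∃ P Q : LeftInvariantProjection A, P.Equiv Q ∧ x = .of P - .of Q} ∪
      {x | ∃ T P Q : LeftInvariantProjection A, T.IsDirectSum P Q ∧ x = .of T - (.of P + .of Q)})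

instance (A : RightModuleAlgebra U B) : AddCommGroup (RightK0 A) :=
  inferInstanceAs (AddCommGroup (_ ⧸ _))

instance (A : LeftModuleAlgebra U B) : AddCommGroup (LeftK0 A) :=
  inferInstanceAs (AddCommGroup (_ ⧸ _))

/-- The class `[P]` of an invariant projection. -/
def RightK0.of {A : RightModuleAlgebra U B} (P : RightInvariantProjection A) : RightK0 A :=
  QuotientAddGroup.mk (FreeAbelianGroup.of P)

/-- The class `[P]` of an invariant projection. -/
def LeftK0.of {A : LeftModuleAlgebra U B} (P : LeftInvariantProjection A) : LeftK0 A :=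
  QuotientAddGroup.mk (FreeAbelianGroup.of P)

/-- `x` is the class in `ᵁK₀(B)` of the matrix `M` with anti-representation `ρ`; in particular `M`
is a right invariant projection. -/
def RightK0.IsClassOf {A : RightModuleAlgebra U B} (x : RightK0 A)
    (ρ : Uᵐᵒᵖ →ₐ[ℂ] Matrix (Fin N) (Fin N) ℂ) (M : Matrix (Fin N) (Fin N) B) : Prop :=
  ∃ (hM : IsIdempotentElem M) (hρ : IsRightInvariant A ρ ρ M),
    x = RightK0.of ⟨N, ρ, M, hM, hρ⟩

/-- `x` is the class in `K₀(B)ᵁ` of the matrix `M` with anti-representation `ρ`; in particular `M`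
is a left invariant projection. -/
def LeftK0.IsClassOf {A : LeftModuleAlgebra U B} (x : LeftK0 A)
    (ρ : Uᵐᵒᵖ →ₐ[ℂ] Matrix (Fin N) (Fin N) ℂ) (M : Matrix (Fin N) (Fin N) B) : Prop :=
  ∃ (hM : IsIdempotentElem M) (hρ : IsLeftInvariant A ρ ρ M),
    x = LeftK0.of ⟨N, ρ, M, hM, hρ⟩

end Invariant

namespace Datum

variable {ι : Type*} {D : Datum ι}

/-! ### `ℂ_q[G]` as a module algebra, and the matrix units -/

variable (D) in
/-- The right action `◁` of `U_q(𝔤)` on `ℂ_q[G]`. -/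
def rightModuleAlgebra : RightModuleAlgebra D.Uq D.CqG where
  act := LinearMap.mk₂ ℂ (fun X φ => ⟨rightActDual X φ.1, rightActDual_mem X φ.1 φ.2⟩)
    (fun _ _ _ => Subtype.ext (by simp)) (fun _ _ _ => Subtype.ext (by simp))
    (fun _ _ _ => Subtype.ext (by simp)) (fun _ _ _ => Subtype.ext (by simp))
  act_one φ := Subtype.ext (by ext Y; simp)
  act_mul X Y φ := Subtype.ext (by ext Z; simp [mul_assoc])
  act_unit X := Subtype.ext (by ext Y; simp)
  act_prod X a b := Subtype.ext (by
    ext Y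
    change LinearMap.mul' ℂ ℂ (TensorProduct.map a.1.ofConv b.1.ofConv (comulHom (X * Y))) = _
    rw [comul_eq, map_mul]
    generalize comulHom X = t
    induction t using TensorProduct.induction_on with
    | zero => simp
    | add x y hx hy => simp only [add_mul, map_add, hx, hy]; rfl
    | tmul x y =>
      change _ = LinearMap.mul' ℂ ℂ (TensorProduct.map (rightActDual x a.1).ofConv
        (rightActDual y b.1).ofConv (comulHom Y))
      generalize comulHom Y = s
      induction s using TensorProduct.induction_on with
      | zero => simp
      | add x y hx hy => simp only [mul_add, map_add, hx, hy]
      | tmul z w => simp [rightActDual])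

variable (D) in
/-- The left action `▷` of `U_q(𝔤)` on `ℂ_q[G]`. -/
def leftModuleAlgebra : LeftModuleAlgebra D.Uq D.CqG where
  act := LinearMap.mk₂ ℂ (fun X φ => ⟨leftActDual X φ.1, leftActDual_mem X φ.1 φ.2⟩)
    (fun _ _ _ => Subtype.ext (by simp)) (fun _ _ _ => Subtype.ext (by simp))
    (fun _ _ _ => Subtype.ext (by simp)) (fun _ _ _ => Subtype.ext (by simp))
  act_one φ := Subtype.ext (by ext Y; simp)
  act_mul X Y φ := Subtype.ext (by ext Z; simp [mul_assoc])
  act_unit X := Subtype.ext (by ext Y; simp [mul_comm])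
  act_prod X a b := Subtype.ext (by
    ext Y
    change LinearMap.mul' ℂ ℂ (TensorProduct.map a.1.ofConv b.1.ofConv (comulHom (Y * X))) = _
    rw [comul_eq, map_mul]
    generalize comulHom X = t
    induction t using TensorProduct.induction_on with
    | zero => simp
    | add x y hx hy => simp only [mul_add, map_add, hx, hy]; rfl
    | tmul x y =>
      change _ = LinearMap.mul' ℂ ℂ (TensorProduct.map (leftActDual x a.1).ofConv
        (leftActDual y b.1).ofConv (comulHom Y))
      generalize comulHom Y = s
      induction s using TensorProduct.induction_on with
      | zero => simp
      | add x y hx hy => simp only [add_mul, map_add, hx, hy]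
      | tmul z w => simp [leftActDual])

section MatrixUnits

variable {V : Type*} [NormedAddCommGroup V] [InnerProductSpace ℂ V] [FiniteDimensional ℂ V]

/-- Unitarity with respect to the compact real form. -/
def IsUnitary (π : D.Uq →ₐ[ℂ] Module.End ℂ V) : Prop :=
  ∀ (X : D.Uq) (v w : V), ⟪π X v, w⟫_ℂ = ⟪v, π (starU X) w⟫_ℂ

variable {N : ℕ} {π : D.Uq →ₐ[ℂ] Module.End ℂ V} {Λ : ι → ℕ}

/-- The matrix coefficients `u^i_j(X) = f^i(X ▷ v_j)`. -/
def u (hπ : IsIrreducibleOfHighestWeight π Λ) (v : OrthonormalBasis (Fin N) ℂ V) (i j : Fin N) :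
    D.CqG :=
  ⟨coeff π (v.toBasis.coord i) (v j), coeff_mem hπ.isTypeOne _ _⟩

/-- The matrix unit `M^n_m`, with entries `(M^n_m)^i_j = (u^m_i)* u^n_j`. -/
def matM (hπ : IsIrreducibleOfHighestWeight π Λ) (v : OrthonormalBasis (Fin N) ℂ V)
    (n m : Fin N) : Matrix (Fin N) (Fin N) D.CqG :=
  .of fun i j => CqG.star (u hπ v m i) * u hπ v n j

/-- The matrix unit `N^n_m`, with entries `(N^n_m)^i_j = u^i_m (u^j_n)*`. -/
def matN (hπ : IsIrreducibleOfHighestWeight π Λ) (v : OrthonormalBasis (Fin N) ℂ V)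
    (n m : Fin N) : Matrix (Fin N) (Fin N) D.CqG :=
  .of fun i j => u hπ v i m * CqG.star (u hπ v j n)

/-- `P = ∑ c^m_n M^n_m`. -/
def matP (hπ : IsIrreducibleOfHighestWeight π Λ) (v : OrthonormalBasis (Fin N) ℂ V)
    (c : Fin N → Fin N → ℂ) : Matrix (Fin N) (Fin N) D.CqG :=
  ∑ m, ∑ n, c m n • matM hπ v n m

/-- `Q = ∑ c^m_n N^n_m`. -/
def matQ (hπ : IsIrreducibleOfHighestWeight π Λ) (v : OrthonormalBasis (Fin N) ℂ V)
    (c : Fin N → Fin N → ℂ) : Matrix (Fin N) (Fin N) D.CqG :=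
  ∑ m, ∑ n, c m n • matN hπ v n m

/-- The matrix of `π(X)` in the basis `v`: `X ▷ v_i = ∑_j π(X)^j_i v_j`. -/
def repMatrix (π : D.Uq →ₐ[ℂ] Module.End ℂ V) (v : OrthonormalBasis (Fin N) ℂ V) (X : D.Uq) :
    Matrix (Fin N) (Fin N) ℂ :=
  LinearMap.toMatrix v.toBasis v.toBasis (π X)

end MatrixUnits

end Datum

/-! ### The data of a simple Lie algebra -/

section LieData

variable {ι M N : Type*} [Fintype ι] [AddCommGroup M] [Module ℂ M] [AddCommGroup N] [Module ℂ N]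
  {P : RootPairing ι ℂ M N} [P.IsCrystallographic]

variable (P) in
/-- `(α, α) / 2` for the invariant form normalized so that short roots satisfy `(α, α) = 2`, that
is, the squared length of `α` divided by the squared length of a shortest root. (For an irreducible
root system the invariant form is unique up to scaling; we scale Mathlib's canonical one.) -/
def halfSqLength (i : ι) : ℝ :=
  ((P.posRootForm ℤ).rootLength i : ℝ) / ⨅ j, ((P.posRootForm ℤ).rootLength j : ℝ)

theorem halfSqLength_pos (i : ι) : 0 < halfSqLength P i := by
  have : Nonempty ι := ⟨i⟩
  obtain ⟨j, hj⟩ := exists_eq_ciInf_of_finite (f := fun j => ((P.posRootForm ℤ).rootLength j : ℝ))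
  unfold halfSqLength
  rw [← hj]
  exact div_pos (Int.cast_pos.2 ((P.posRootForm ℤ).rootLength_pos i))
    (Int.cast_pos.2 ((P.posRootForm ℤ).rootLength_pos j))

/-- The Cartan matrix `a_ij = 2 (α_i, α_j) / (α_i, α_i)` (the transpose of Mathlib's convention)
and the numbers `d_i = (α_i, α_i) / 2` attached to a base of a root system. -/
def Datum.ofBase (b : P.Base) (q : ℝ) (hq0 : 0 < q) (hq1 : q ≠ 1) : Datum b.support where
  a i j := b.cartanMatrix j i
  d i := halfSqLength P i
  q := q
  a_diag i := b.cartanMatrix_apply_same i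
  a_nonpos i j h := b.cartanMatrix_le_zero_of_ne j i h.symm
  d_pos i := halfSqLength_pos _
  symm i j := by
    have := (P.posRootForm ℤ).pairingIn_mul_eq_pairingIn_mul_swap (i : ι) (j : ι)
    have h2 : ((b.cartanMatrix j i : ℤ) : ℝ) * ((P.posRootForm ℤ).rootLength i : ℝ) =
        ((b.cartanMatrix i j : ℤ) : ℝ) * ((P.posRootForm ℤ).rootLength j : ℝ) := by
      exact_mod_cast this
    unfold halfSqLength
    rw [div_mul_eq_mul_div, div_mul_eq_mul_div, mul_comm, h2, mul_comm]
  q_pos := hq0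
  q_ne_one := hq1

open scoped Classical in
/-- The coefficients `n_i` of `2ρ = ∑_{α > 0} α = ∑ n_i α_i`. -/
def twoRho (b : P.Base) (i : b.support) : ℤ :=
  ∑ β : ι, if b.IsPos β then b.toWeightBasisInt.repr (P.rootSpanMem ℤ β) i else 0

end LieData

end QuantumGroup

end

/-!
Conjugation by `K_{2ρ}` implements `S²`, because the simple reflection `s_j` permutes the positive
roots other than `α_j`, so that `⟨2ρ, α_j^∨⟩ = 2`. Hence `ρ°` is `π ∘ S⁻¹` in 1) and `π ∘ S` in 2).
For the matrix `u` of coefficients of `π`, the matrix `𝖯 = u* c u` satisfies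
`X ▷ 𝖯 = π(S(X₁)) 𝖯 π(X₂)` and `𝖰 = u c u*` satisfies `𝖰 ◁ X = π(X₁) 𝖰 π(S(X₂))`, since unitarity
turns `u*` into `u ∘ S`. With these choices of `ρ°` the outer factors in the definition of
invariance cancel against `π`, by the antipode axiom.
-/

namespace QuantumGroup

theorem reflectionPerm_ne_of_isPos {ι R M N : Type*} [CommRing R] [CharZero R] [AddCommGroup M]
    [Module R M] [AddCommGroup N] [Module R N] {P : RootPairing ι R M N} (b : P.Base) {j β : ι}
    (hj : j ∈ b.support) (hβ : b.IsPos β) : P.reflectionPerm j β ≠ j := by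
  intro h
  have hβj : β = P.reflectionPerm j j := by rw [← P.reflectionPerm_self j β, h]
  have height_neg : b.height β = -b.height j := hβj ▸ b.height_reflectionPerm_self j
  have height_j_pos := b.isPos_iff.mp (b.isPos_of_mem_support hj)
  have height_β_pos := b.isPos_iff.mp hβ
  omega

open scoped Classical in
/-- The simple reflection `s_j` permutes the positive roots other than `α_j` and changes the sign of
the pairing with `α_j^∨`, so only `α_j` itself contributes to the sum. -/
theorem sum_isPos_pairingIn {ι R M N : Type*} [Fintype ι] [CommRing R] [IsDomain R] [CharZero R]
    [AddCommGroup M] [Module R M] [AddCommGroup N] [Module R N] {P : RootPairing ι R M N}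
    [P.IsCrystallographic] [P.IsReduced] (b : P.Base) {j : ι} (hj : j ∈ b.support) :
    ∑ β : ι, (if b.IsPos β then P.pairingIn ℤ β j else 0) = 2 := by
  have pairing_neg (β : ι) : P.pairingIn ℤ (P.reflectionPerm j β) j = -P.pairingIn ℤ β j := by
    rw [← P.pairingIn_reflectionPerm, P.pairingIn_reflectionPerm_self_right]
  have sum_erase : ∑ β ∈ ({β | b.IsPos β} : Finset ι).erase j, P.pairingIn ℤ β j = 0 := by
    refine Finset.sum_involution (fun β _ => P.reflectionPerm j β) (fun β _ => ?_)
      (fun β _ hne hfix => ?_) (fun β hβ => ?_) (fun β _ => P.reflectionPerm_self j β)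
    · rw [pairing_neg, add_neg_cancel]
    · have := pairing_neg β
      rw [hfix] at this
      omega
    · simp only [Finset.mem_erase, Finset.mem_filter_univ] at hβ ⊢
      exact ⟨reflectionPerm_ne_of_isPos b hj hβ.2, hβ.2.reflectionPerm hj hβ.1⟩
  have hj_mem : j ∈ ({β | b.IsPos β} : Finset ι) := by simpa using b.isPos_of_mem_support hj
  rw [← Finset.sum_filter, ← Finset.add_sum_erase _ _ hj_mem, sum_erase,
    P.pairingIn_same ℤ, add_zero]

theorem sum_repr_mul_cartanMatrix {ι R M N : Type*} [CommRing R] [CharZero R]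
    [AddCommGroup M] [Module R M] [AddCommGroup N] [Module R N] {P : RootPairing ι R M N}
    [P.IsCrystallographic] [P.IsReduced] (b : P.Base) (β : ι)
    (j : b.support) :
    ∑ i, b.toWeightBasisInt.repr (P.rootSpanMem ℤ β) i * b.cartanMatrix i j =
      P.pairingIn ℤ β j := by
  have basis_eq (i : b.support) : b.toWeightBasisInt i = P.rootSpanMem ℤ i :=
    Subtype.ext (b.coe_toWeightBasisInt_apply i)
  calc ∑ i, b.toWeightBasisInt.repr (P.rootSpanMem ℤ β) i * b.cartanMatrix i j
    _ = P.coroot'In ℤ j (∑ i, b.toWeightBasisInt.repr (P.rootSpanMem ℤ β) i •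
          b.toWeightBasisInt i) := by
      simp only [map_sum, map_smul, basis_eq, P.coroot'In_rootSpanMem_eq_pairingIn, smul_eq_mul]
      rfl
    _ = P.pairingIn ℤ β j := by
      rw [b.toWeightBasisInt.sum_repr, P.coroot'In_rootSpanMem_eq_pairingIn]

theorem sum_twoRho_mul_cartanMatrix {ι M N : Type*} [Fintype ι] [AddCommGroup M] [Module ℂ M]
    [AddCommGroup N] [Module ℂ N] {P : RootPairing ι ℂ M N} [P.IsCrystallographic] [P.IsReduced]
    (b : P.Base) (j : b.support) : ∑ i, twoRho b i * b.cartanMatrix i j = 2 := by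
  classical
  simp only [twoRho, Finset.sum_mul]
  rw [← sum_isPos_pairingIn b j.2, Finset.sum_comm]
  simp only [ite_mul, zero_mul]
  refine Finset.sum_congr rfl fun β _ => ?_
  split_ifs
  · exact sum_repr_mul_cartanMatrix b β j
  · exact Finset.sum_const_zero

section ScaledConjugation

variable {k A : Type*} [Monoid A]

theorem semiconjBy_pow_smul [Monoid k] [MulAction k A] [SMulCommClass k A A] [IsScalarTower k A A]
    {a x : A} {c : k} (h : SemiconjBy a x (c • x)) (n : ℕ) : SemiconjBy (a ^ n) x (c ^ n • x) := by
  induction n with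
  | zero => simp
  | succ n ih =>
    rw [pow_succ' a, pow_succ c, mul_smul]
    exact (h.smul_right (c ^ n)).mul_left ih

theorem semiconjBy_zpow_smul [GroupWithZero k] [MulAction k A] [SMulCommClass k A A]
    [IsScalarTower k A A] {a : Aˣ} {x : A} {c : k} (hc : c ≠ 0)
    (h : SemiconjBy (a : A) x (c • x)) : ∀ n : ℤ, SemiconjBy (↑(a ^ n) : A) x (c ^ n • x)
  | (n : ℕ) => by simpa using semiconjBy_pow_smul h n
  | Int.negSucc n => by
    have h_inv := SemiconjBy.units_inv_symm_left
      (by simpa using semiconjBy_pow_smul h (n + 1) :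
        SemiconjBy (↑(a ^ (n + 1)) : A) x (c ^ (n + 1) • x))
    simpa [smul_smul, hc] using h_inv.smul_right (c ^ (n + 1))⁻¹

theorem semiconjBy_noncommProd_smul {ι : Type*} [CommMonoid k] [MulAction k A]
    [SMulCommClass k A A] [IsScalarTower k A A] (s : Finset ι) (a : ι → Aˣ)
    (comm : (s : Set ι).Pairwise fun i j => Commute (a i) (a j)) {x : A} {c : ι → k}
    (h : ∀ i ∈ s, SemiconjBy (a i : A) x (c i • x)) :
    SemiconjBy (↑(s.noncommProd a comm) : A) x ((∏ i ∈ s, c i) • x) := by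
  classical
  induction s using Finset.induction_on with
  | empty => simp
  | insert i s hi ih =>
    rw [Finset.noncommProd_insert_of_notMem _ _ _ _ hi, Finset.prod_insert hi, mul_comm, mul_smul,
      Units.val_mul]
    exact ((h i (Finset.mem_insert_self i s)).smul_right _).mul_left
      (ih _ fun j hj => h j (Finset.mem_insert_of_mem hj))

end ScaledConjugation

namespace Datum

variable {ι : Type*} {D : Datum ι}

theorem semiconjBy_Klam [Fintype ι] (n : ι → ℤ) {x : D.Uq} {c : ι → ℂ} (hc : ∀ i, c i ≠ 0)
    (h : ∀ i, D.K i * x = c i • (x * D.K i)) :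
    SemiconjBy (D.Klam n : D.Uq) x ((∏ i, c i ^ n i) • x) :=
  semiconjBy_noncommProd_smul _ _ _ fun i _ => semiconjBy_zpow_smul (a := D.unitK i) (hc i)
    ((h i).trans (smul_mul_assoc _ _ _).symm) (n i)

theorem prod_qi_zpow_eq_sq [Fintype ι] {n : ι → ℤ} {j : ι} (hn : ∑ i, n i * D.a j i = 2) :
    ∏ i, (D.qi i ^ D.a i j) ^ n i = D.qi j ^ 2 := by
  have zpow_sum (s : Finset ι) :
      ∏ i ∈ s, D.qi j ^ (n i * D.a j i) = D.qi j ^ ∑ i ∈ s, n i * D.a j i := by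
    classical
    induction s using Finset.induction_on with
    | empty => simp
    | insert i s hi ih => rw [Finset.prod_insert hi, Finset.sum_insert hi, ih,
        zpow_add₀ (D.qi_ne_zero j)]
  simp only [D.qi_symm _ j, ← zpow_mul, mul_comm _ (n _), zpow_sum, hn]
  rfl

theorem antipode_antipode_E (j : ι) :
    antipodeLin (antipodeLin (D.E j)) = D.qi j ^ 2 • D.E j := by
  simp only [antipodeLin_E, map_neg, antipodeLin_mul, antipodeLin_K', mul_neg, neg_neg]
  rw [← mul_assoc, D.relations.k_e, D.a_diag, smul_mul_assoc, mul_assoc, D.relations.kk', mul_one]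
  rfl

theorem antipode_antipode_F (j : ι) :
    antipodeLin (antipodeLin (D.F j)) = (D.qi j ^ 2)⁻¹ • D.F j := by
  simp only [antipodeLin_F, map_neg, antipodeLin_mul, antipodeLin_K, neg_mul, neg_neg]
  rw [D.relations.kf, D.a_diag, zpow_neg]
  rfl

theorem semiconjBy_Klam_antipode_antipode [Fintype ι] {n : ι → ℤ}
    (hn : ∀ j, ∑ i, n i * D.a j i = 2) (X : D.Uq) :
    SemiconjBy (D.Klam n : D.Uq) X (antipodeLin (antipodeLin X)) := by
  have rel := D.relations
  have hE (j : ι) : SemiconjBy (D.Klam n : D.Uq) (D.E j) (D.qi j ^ 2 • D.E j) :=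
    prod_qi_zpow_eq_sq (hn j) ▸
      semiconjBy_Klam n (fun i => zpow_ne_zero _ (D.qi_ne_zero i)) fun i => rel.k_e i j
  have hF (j : ι) : SemiconjBy (D.Klam n : D.Uq) (D.F j) ((D.qi j ^ 2)⁻¹ • D.F j) := by
    simpa only [← prod_qi_zpow_eq_sq (hn j), zpow_neg, inv_zpow, Finset.prod_inv_distrib] using
      semiconjBy_Klam n (fun i => zpow_ne_zero _ (D.qi_ne_zero i)) fun i => rel.k_f i j
  have commute_of_commute_K {x : D.Uq} (h : ∀ i, D.K i * x = x * D.K i) :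
      SemiconjBy (D.Klam n : D.Uq) x x := by
    simpa using semiconjBy_Klam n (c := fun _ => 1) (fun _ => one_ne_zero) fun i =>
      (h i).trans (one_smul ℂ (x * D.K i)).symm
  induction X using induction_gen with
  | h1 => simp
  | hE j x ih => simpa only [antipodeLin_mul, antipode_antipode_E] using (hE j).mul_right ih
  | hF j x ih => simpa only [antipodeLin_mul, antipode_antipode_F] using (hF j).mul_right ih
  | hK j x ih =>
    simpa only [antipodeLin_mul, antipodeLin_K, antipodeLin_K'] using
      (commute_of_commute_K fun i => rel.comm i j).mul_right ih
  | hK' j x ih =>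
    simpa only [antipodeLin_mul, antipodeLin_K, antipodeLin_K'] using
      (commute_of_commute_K fun i => (rel.k'_k j i).symm).mul_right ih
  | hadd x y hx hy => simpa only [map_add] using hx.add_right hy
  | hsmul c x hx => simpa only [map_smul] using hx.smul_right c

end Datum

section Antipode

open Coalgebra HopfAlgebra LinearMap WithConv

variable {R C A : Type*} [CommSemiring R] [Semiring C] [HopfAlgebra R C] [Semiring A] [Algebra R A]

theorem algHom_convMul_comp_antipode (τ : C →ₐ[R] A) :
    toConv τ.toLinearMap * toConv (τ.toLinearMap ∘ₗ antipode R) = 1 := by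
  have h := LinearMap.algHom_comp_convMul_distrib τ (toConv .id) (toConv (antipode R))
  rw [id_mul_antipode] at h
  ext x
  simpa using congr($h x).symm

theorem algHom_comp_antipode_convMul (τ : C →ₐ[R] A) :
    toConv (τ.toLinearMap ∘ₗ antipode R) * toConv τ.toLinearMap = 1 := by
  have h := LinearMap.algHom_comp_convMul_distrib τ (toConv (antipode R)) (toConv .id)
  rw [antipode_mul_id] at h
  ext x
  simpa using congr($h x).symm

/-- Both sides are convolution inverse to `Δ = i₁ * i₂`, where `i₁ x = x ⊗ 1` and `i₂ x = 1 ⊗ x`: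
the right-hand side is `(i₂ ∘ S) * (i₁ ∘ S)`. -/
theorem comul_comp_antipode :
    comul ∘ₗ antipode R =
      (TensorProduct.comm R C C).toLinearMap ∘ₗ
        TensorProduct.map (antipode R) (antipode R) ∘ₗ comul := by
  let i₁ : C →ₐ[R] C ⊗[R] C := Algebra.TensorProduct.includeLeft
  let i₂ : C →ₐ[R] C ⊗[R] C := Algebra.TensorProduct.includeRight
  have comul_eq : toConv comul = toConv i₁.toLinearMap * toConv i₂.toLinearMap := by
    have h : mul' R (C ⊗[R] C) ∘ₗ TensorProduct.map i₁.toLinearMap i₂.toLinearMap = .id :=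
      TensorProduct.ext' fun x y => by simp [i₁, i₂]
    exact WithConv.ext (by rw [LinearMap.convMul_def, ofConv_toConv, ← comp_assoc, h, id_comp])
  have swap_eq : toConv ((TensorProduct.comm R C C).toLinearMap ∘ₗ
      TensorProduct.map (antipode R) (antipode R) ∘ₗ comul) =
      toConv (i₂.toLinearMap ∘ₗ antipode R) * toConv (i₁.toLinearMap ∘ₗ antipode R) := by
    have h : mul' R (C ⊗[R] C) ∘ₗ TensorProduct.map (i₂.toLinearMap ∘ₗ antipode R)
        (i₁.toLinearMap ∘ₗ antipode R) = (TensorProduct.comm R C C).toLinearMap ∘ₗ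
          TensorProduct.map (antipode R) (antipode R) :=
      TensorProduct.ext' fun x y => by simp [i₁, i₂]
    exact WithConv.ext (by rw [LinearMap.convMul_def, ← comp_assoc, ← comp_assoc, h])
  refine toConv_injective (left_inv_eq_right_inv ?_ comul_right_inv).symm
  rw [swap_eq, comul_eq, mul_assoc, ← mul_assoc (toConv (i₁.toLinearMap ∘ₗ antipode R)),
    algHom_comp_antipode_convMul, one_mul, algHom_comp_antipode_convMul]

end Antipode

section AntipodeInverse

open Coalgebra HopfAlgebra AntipodeInverse

variable {U : Type*} [Ring U] [HopfAlgebra ℂ U] [AntipodeInverse U]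

theorem antipode_injective : Function.Injective (antipode ℂ : U →ₗ[ℂ] U) :=
  Function.LeftInverse.injective inv_antipode

variable (U) in
/-- The inverse `S⁻¹` of the antipode as an anti-homomorphism of algebras; its counterpart for
`S` is `HopfAlgebra.antipodeAlgHomOp`. -/
noncomputable def antipodeInvAlgHomOp : U →ₐ[ℂ] Uᵐᵒᵖ :=
  .ofLinearMap ((MulOpposite.opLinearEquiv ℂ).toLinearMap ∘ₗ inv)
    (MulOpposite.unop_injective <| antipode_injective <| by simp [antipode_inv])
    fun X Y => MulOpposite.unop_injective <| antipode_injective <| by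
      simp [antipode_inv, antipode_mul_antidistrib]

theorem counit_inv (X : U) : counit (R := ℂ) (inv X) = counit (R := ℂ) X := by
  rw [← counit_antipode (inv X), antipode_inv]

theorem comul_inv (X : U) :
    comul (R := ℂ) (inv X) =
      TensorProduct.comm ℂ U U (TensorProduct.map inv inv (comul (R := ℂ) X)) := by
  have h : comul (R := ℂ) X = TensorProduct.comm ℂ U U
      (TensorProduct.map (antipode ℂ) (antipode ℂ) (comul (R := ℂ) (inv X))) := by
    simpa [antipode_inv] using congr($(comul_comp_antipode (R := ℂ) (C := U)) (inv X))
  have hinv : (inv : U →ₗ[ℂ] U) ∘ₗ antipode ℂ = .id := LinearMap.ext inv_antipode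
  rw [h, TensorProduct.map_comm, ← LinearMap.comp_apply (TensorProduct.map _ _),
    ← TensorProduct.map_comp, hinv]
  simp

variable (U) in
/-- The inverse `S⁻²` of the squared antipode; unlike `S⁻¹`, it is a homomorphism of coalgebras. -/
noncomputable def antipodeInvSq : U →ₗc[ℂ] U where
  toLinearMap := inv ∘ₗ inv
  counit_comp := LinearMap.ext fun X => by simp [counit_inv]
  map_comp_comul := LinearMap.ext fun X => by
    simp [comul_inv, TensorProduct.map_comm, TensorProduct.map_map]

section InnerSquare

variable {K : Uˣ} (hK : ∀ X : U, SemiconjBy (K : U) X (antipode ℂ (antipode ℂ X)))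
include hK

theorem conj_antipodeInv_eq_antipode (X : U) : K * inv X * ↑K⁻¹ = antipode ℂ X := by
  rw [(hK (inv X)).eq, antipode_inv, Units.mul_inv_cancel_right]

theorem conj_symm_antipode_eq_antipodeInv (X : U) : ↑K⁻¹ * antipode ℂ X * K = inv X := by
  rw [← conj_antipodeInv_eq_antipode hK, mul_assoc, Units.inv_mul_cancel_right,
    Units.inv_mul_cancel_left]

end InnerSquare

end AntipodeInverse

section MatrixConvolution

open Coalgebra

variable {U B : Type*} [Ring U] [HopfAlgebra ℂ U] [Ring B] [Algebra ℂ B]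
variable {l m n p : Type*} [Fintype m]

theorem matConv_apply_repr (f : U →ₗ[ℂ] Matrix l m B) (g : U →ₗ[ℂ] Matrix m n B) {X : U}
    {κ : Type*} (r : Coalgebra.Repr ℂ X κ) :
    matConv f g X = ∑ i ∈ r.index, f (r.left i) * g (r.right i) := by
  simp [matConv, ← r.eq, matMul]

theorem matConv_assoc [Fintype n] (f : U →ₗ[ℂ] Matrix l m B) (g : U →ₗ[ℂ] Matrix m n B)
    (h : U →ₗ[ℂ] Matrix n p B) : matConv (matConv f g) h = matConv f (matConv g h) := by
  let fgh : U ⊗[ℂ] (U ⊗[ℂ] U) →ₗ[ℂ] Matrix l p B :=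
    TensorProduct.lift (matMul.compl₁₂ f (TensorProduct.lift (matMul.compl₁₂ g h)))
  have left_eq : TensorProduct.lift (matMul.compl₁₂ (matConv f g) h) =
      fgh ∘ₗ (TensorProduct.assoc ℂ U U U).toLinearMap ∘ₗ comul.rTensor U :=
    TensorProduct.ext' fun X Y => by
      simp [fgh, matMul, matConv_apply_repr f g (ℛ ℂ X), ← (ℛ ℂ X).eq,
        TensorProduct.sum_tmul, Matrix.mul_assoc]
  have right_eq : TensorProduct.lift (matMul.compl₁₂ f (matConv g h)) = fgh ∘ₗ comul.lTensor U :=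
    TensorProduct.ext' fun X Y => by simp [fgh, matConv]
  calc matConv (matConv f g) h
      = fgh ∘ₗ (TensorProduct.assoc ℂ U U U).toLinearMap ∘ₗ comul.rTensor U ∘ₗ comul :=
        congr($left_eq ∘ₗ comul)
    _ = fgh ∘ₗ comul.lTensor U ∘ₗ comul := by rw [coassoc]
    _ = matConv f (matConv g h) := congr($right_eq.symm ∘ₗ comul)

theorem matConv_counit_left (M : Matrix l m B) (f : U →ₗ[ℂ] Matrix m n B) :
    matConv (counit.smulRight M) f = matMul M ∘ₗ f := by
  ext1 X
  rw [matConv_apply_repr _ _ (ℛ ℂ X)]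
  conv_rhs => rw [← sum_counit_smul (ℛ ℂ X)]
  simp [matMul]

theorem matConv_matMul_comp [Fintype n] (M : Matrix l m B) (f : U →ₗ[ℂ] Matrix m n B)
    (g : U →ₗ[ℂ] Matrix n p B) : matConv (matMul M ∘ₗ f) g = matMul M ∘ₗ matConv f g := by
  ext1 X
  simp [matConv_apply_repr _ _ (ℛ ℂ X), matMul, Matrix.mul_assoc]

theorem matConv_comp_matMul [Fintype n] (f : U →ₗ[ℂ] Matrix l m B) (g : U →ₗ[ℂ] Matrix m n B)
    (M : Matrix n p B) : matConv f (matMul.flip M ∘ₗ g) = matMul.flip M ∘ₗ matConv f g := by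
  ext1 X
  simp [matConv_apply_repr _ _ (ℛ ℂ X), matMul, Matrix.mul_assoc]

theorem matConv_comp_coalgHom (f : U →ₗ[ℂ] Matrix l m B) (g : U →ₗ[ℂ] Matrix m n B)
    (φ : U →ₗc[ℂ] U) :
    matConv (f ∘ₗ φ.toLinearMap) (g ∘ₗ φ.toLinearMap) = matConv f g ∘ₗ φ.toLinearMap := by
  have h : TensorProduct.lift (matMul.compl₁₂ (f ∘ₗ φ.toLinearMap) (g ∘ₗ φ.toLinearMap)) =
      TensorProduct.lift (matMul.compl₁₂ f g) ∘ₗ TensorProduct.map φ.toLinearMap φ.toLinearMap :=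
    TensorProduct.ext' fun _ _ => rfl
  simp only [matConv, h, LinearMap.comp_assoc, φ.map_comp_comul]

/-- Sweedler form: `f'(X₁) f(X₂) x y g'(X₃) g(X₄) = ε(X) x y`. -/
theorem matConv_conj_mul [Fintype l] [Fintype n] [DecidableEq l] [DecidableEq n]
    {f f' : U →ₗ[ℂ] Matrix l l B} {g g' : U →ₗ[ℂ] Matrix n n B}
    (hf : matConv f' f = counit.smulRight 1) (hg : matConv g' g = counit.smulRight 1)
    (x : Matrix l m B) (y : Matrix m n B) :
    matConv (matConv f' (matConv (matMul.flip x ∘ₗ f) (matMul y ∘ₗ g'))) g =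
      counit.smulRight (x * y) := by
  have absorb_left : matConv f' (matMul.flip x ∘ₗ f) = counit.smulRight x := by
    rw [matConv_comp_matMul, hf]
    ext1 X
    simp [matMul]
  have absorb_right : matConv (matMul y ∘ₗ g') g = counit.smulRight y := by
    rw [matConv_matMul_comp, hg]
    ext1 X
    simp [matMul]
  rw [← matConv_assoc, absorb_left, matConv_assoc, absorb_right, matConv_counit_left]
  ext1 X
  simp [matMul]

theorem entrywise_mul {T : U →ₗ[ℂ] B →ₗ[ℂ] B}
    (hT : ∀ X a b, T X (a * b) =
      LinearMap.mul' ℂ B (TensorProduct.map (T.flip a) (T.flip b) (comul (R := ℂ) X)))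
    (x : Matrix l m B) (y : Matrix m n B) :
    entrywise T (x * y) = matConv (entrywise T x) (entrywise T y) := by
  ext1 X
  rw [matConv_apply_repr _ _ (ℛ ℂ X)]
  ext i j
  simpa [entrywise, Matrix.mul_apply, Matrix.sum_apply, hT, ← (ℛ ℂ X).eq] using Finset.sum_comm

theorem matConv_eq_counit_of_convMul_eq_one [Fintype n] [DecidableEq n]
    {f g : U →ₗ[ℂ] Matrix n n B} (h : WithConv.toConv f * WithConv.toConv g = 1) :
    matConv f g = counit.smulRight 1 := by
  ext1 X
  have hX : ∑ i ∈ (ℛ ℂ X).index, f ((ℛ ℂ X).left i) * g ((ℛ ℂ X).right i) =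
      algebraMap ℂ (Matrix n n B) (counit X) := by
    simpa [LinearMap.convMul_def, ← (ℛ ℂ X).eq] using congr($h X)
  rw [matConv_apply_repr f g (ℛ ℂ X), hX, Algebra.algebraMap_eq_smul_one, LinearMap.smulRight_apply]

theorem matConv_scalarMat_comp_antipode [Fintype n] [DecidableEq n] (τ : U →ₐ[ℂ] Matrix n n ℂ) :
    matConv (scalarMat B τ.toLinearMap)
      (scalarMat B (τ.toLinearMap ∘ₗ HopfAlgebra.antipode ℂ)) = counit.smulRight 1 :=
  matConv_eq_counit_of_convMul_eq_one <|
    algHom_convMul_comp_antipode ((Algebra.ofId ℂ B).mapMatrix.comp τ)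

theorem matConv_scalarMat_antipode_comp [Fintype n] [DecidableEq n] (τ : U →ₐ[ℂ] Matrix n n ℂ) :
    matConv (scalarMat B (τ.toLinearMap ∘ₗ HopfAlgebra.antipode ℂ))
      (scalarMat B τ.toLinearMap) = counit.smulRight 1 :=
  matConv_eq_counit_of_convMul_eq_one <|
    algHom_comp_antipode_convMul ((Algebra.ofId ℂ B).mapMatrix.comp τ)

end MatrixConvolution

section InvariantProducts

open HopfAlgebra

variable {U B : Type*} [Ring U] [HopfAlgebra ℂ U] [Ring B] [Algebra ℂ B] {N K : ℕ}

/-- The anti-representation `τ ∘ S` attached to a representation `τ`. -/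
noncomputable def antipodeAntiRep (τ : U →ₐ[ℂ] Matrix (Fin N) (Fin N) ℂ) :
    Uᵐᵒᵖ →ₐ[ℂ] Matrix (Fin N) (Fin N) ℂ :=
  τ.comp (AlgHom.opComm (antipodeAlgHomOp ℂ U))

variable [AntipodeInverse U]

/-- The anti-representation `τ ∘ S⁻¹` attached to a representation `τ`. -/
noncomputable def antipodeInvAntiRep (τ : U →ₐ[ℂ] Matrix (Fin N) (Fin N) ℂ) :
    Uᵐᵒᵖ →ₐ[ℂ] Matrix (Fin N) (Fin N) ℂ :=
  τ.comp (AlgHom.opComm (antipodeInvAlgHomOp U))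

theorem antiRep_antipodeAntiRep_comp_inv (τ : U →ₐ[ℂ] Matrix (Fin N) (Fin N) ℂ) :
    antiRep (antipodeAntiRep τ) ∘ₗ AntipodeInverse.inv = τ.toLinearMap :=
  LinearMap.ext fun X => congr(τ $(AntipodeInverse.antipode_inv X))

theorem antiRep_antipodeInvAntiRep (τ : U →ₐ[ℂ] Matrix (Fin N) (Fin N) ℂ) :
    antiRep (antipodeInvAntiRep τ) =
      (τ.toLinearMap ∘ₗ antipode ℂ) ∘ₗ (antipodeInvSq U).toLinearMap :=
  LinearMap.ext fun X => congr(τ $((AntipodeInverse.antipode_inv (AntipodeInverse.inv X)).symm))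

theorem isRightInvariant_mul (A : RightModuleAlgebra U B) {m : Type*} [Fintype m]
    {τ : U →ₐ[ℂ] Matrix (Fin N) (Fin N) ℂ} {σ : U →ₐ[ℂ] Matrix (Fin K) (Fin K) ℂ}
    {x : Matrix (Fin N) m B} {y : Matrix m (Fin K) B}
    (hx : ∀ X, entrywise A.act x X = scalarMat B τ.toLinearMap X * x)
    (hy : ∀ X, entrywise A.act y X = y * scalarMat B (σ.toLinearMap ∘ₗ antipode ℂ) X) :
    IsRightInvariant A (antipodeAntiRep τ) (antipodeAntiRep σ) (x * y) := by
  have hx' : entrywise A.act x = matMul.flip x ∘ₗ scalarMat B τ.toLinearMap := LinearMap.ext hx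
  have hy' : entrywise A.act y = matMul y ∘ₗ scalarMat B (σ.toLinearMap ∘ₗ antipode ℂ) :=
    LinearMap.ext hy
  refine LinearMap.congr_fun (f := adL A _ _ (x * y)) (g := Coalgebra.counit.smulRight (x * y)) ?_
  rw [adL, entrywise_mul A.act_prod, hx', hy', antiRep_antipodeAntiRep_comp_inv]
  exact matConv_conj_mul (matConv_scalarMat_antipode_comp τ) (matConv_scalarMat_antipode_comp σ) x y

theorem isLeftInvariant_mul (A : LeftModuleAlgebra U B) {m : Type*} [Fintype m]
    {τ : U →ₐ[ℂ] Matrix (Fin N) (Fin N) ℂ} {σ : U →ₐ[ℂ] Matrix (Fin K) (Fin K) ℂ}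
    {x : Matrix (Fin N) m B} {y : Matrix m (Fin K) B}
    (hx : ∀ X, entrywise A.act x X = scalarMat B (τ.toLinearMap ∘ₗ antipode ℂ) X * x)
    (hy : ∀ X, entrywise A.act y X = y * scalarMat B σ.toLinearMap X) :
    IsLeftInvariant A (antipodeInvAntiRep τ) (antipodeInvAntiRep σ) (x * y) := by
  have hx' : entrywise A.act x = matMul.flip x ∘ₗ scalarMat B (τ.toLinearMap ∘ₗ antipode ℂ) :=
    LinearMap.ext hx
  have hy' : entrywise A.act y = matMul y ∘ₗ scalarMat B σ.toLinearMap := LinearMap.ext hy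
  -- As `S⁻¹ = S ∘ S⁻²`, all three factors of `ad°_R` pass through the coalgebra map `S⁻²`.
  have adR_eq : adR A (antipodeInvAntiRep τ) (antipodeInvAntiRep σ) (x * y) =
      matConv (matConv (scalarMat B τ.toLinearMap) (entrywise A.act (x * y)))
        (scalarMat B (σ.toLinearMap ∘ₗ antipode ℂ)) ∘ₗ (antipodeInvSq U).toLinearMap := by
    rw [adR, antiRep_antipodeInvAntiRep σ, ← matConv_comp_coalgHom, ← matConv_comp_coalgHom]
    rfl
  intro X
  rw [adR_eq, entrywise_mul A.act_prod, hx', hy',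
    matConv_conj_mul (matConv_scalarMat_comp_antipode τ) (matConv_scalarMat_comp_antipode σ) x y]
  exact congr($((antipodeInvSq U).counit_comp) X • (x * y))

end InvariantProducts

section ScalarMatrices

variable {R A B : Type*} [CommSemiring R] [Semiring A] [Algebra R A] [Semiring B] [Algebra R B]
variable {l m n : Type*} [Fintype m]

theorem map_mul_map_algebraMap (f : B →ₗ[R] A) (M : Matrix l m B) (C : Matrix m n R) :
    (M * C.map (algebraMap R B)).map f = M.map f * C.map (algebraMap R A) := by
  ext i j
  simp [Matrix.mul_apply, ← Algebra.commutes, ← Algebra.smul_def]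

theorem map_map_algebraMap_mul (f : B →ₗ[R] A) (C : Matrix l m R) (M : Matrix m n B) :
    (C.map (algebraMap R B) * M).map f = C.map (algebraMap R A) * M.map f := by
  ext i j
  simp [Matrix.mul_apply, ← Algebra.smul_def]

end ScalarMatrices

namespace Datum

variable {ι : Type*} {D : Datum ι}

/-- Evaluation of the functionals in `ℂ_q[G]` at an element of `U_q(𝔤)`. -/
def evalAt (Y : D.Uq) : D.CqG →ₗ[ℂ] ℂ where
  toFun φ := φ.1 Y
  map_add' _ _ := rfl
  map_smul' _ _ := rfl

theorem matrix_ext_evalAt {l m : Type*} {M M' : Matrix l m D.CqG}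
    (h : ∀ Y : D.Uq, M.map (evalAt Y) = M'.map (evalAt Y)) : M = M' := by
  ext i j Y
  exact congr_fun₂ (h Y) i j

section CoeffMatrix

variable {V : Type*} [NormedAddCommGroup V] [InnerProductSpace ℂ V]
variable {N : ℕ} {π : D.Uq →ₐ[ℂ] Module.End ℂ V}

/-- `repMatrix π v` as a homomorphism of algebras. -/
noncomputable def repMatrixHom (π : D.Uq →ₐ[ℂ] Module.End ℂ V) (v : OrthonormalBasis (Fin N) ℂ V) :
    D.Uq →ₐ[ℂ] Matrix (Fin N) (Fin N) ℂ :=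
  (LinearMap.toMatrixAlgEquiv v.toBasis).toAlgHom.comp π

theorem repMatrixHom_apply_eq_inner (v : OrthonormalBasis (Fin N) ℂ V) (X : D.Uq) (i j : Fin N) :
    repMatrixHom π v X i j = ⟪v i, π X (v j)⟫_ℂ := by
  simp [repMatrixHom, LinearMap.toMatrixAlgEquiv_apply, v.repr_apply_apply]

variable [FiniteDimensional ℂ V]

/-- The matrix `u = (u^i_j)` of matrix coefficients of a type 1 representation. -/
noncomputable def coeffMatrix (hπ : IsTypeOne π) (v : OrthonormalBasis (Fin N) ℂ V) :
    Matrix (Fin N) (Fin N) D.CqG :=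
  .of fun i j => ⟨coeff π (v.toBasis.coord i) (v j), coeff_mem hπ _ _⟩

/-- The conjugate transpose `u* = ((u^j_i)*)` of `coeffMatrix`. -/
noncomputable def coeffMatrixStar (hπ : IsTypeOne π) (v : OrthonormalBasis (Fin N) ℂ V) :
    Matrix (Fin N) (Fin N) D.CqG :=
  .of fun i j => CqG.star (coeffMatrix hπ v j i)

variable (hπ : IsTypeOne π) (v : OrthonormalBasis (Fin N) ℂ V)

/-- The matrix `u* c u`, which is the paper's `𝖯`. -/
noncomputable def starCoeffConj (c : Matrix (Fin N) (Fin N) ℂ) : Matrix (Fin N) (Fin N) D.CqG :=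
  coeffMatrixStar hπ v * c.map (algebraMap ℂ D.CqG) * coeffMatrix hπ v

/-- The matrix `u c u*`, which is the paper's `𝖰`. -/
noncomputable def coeffConj (c : Matrix (Fin N) (Fin N) ℂ) : Matrix (Fin N) (Fin N) D.CqG :=
  coeffMatrix hπ v * c.map (algebraMap ℂ D.CqG) * coeffMatrixStar hπ v

theorem coeffMatrix_map_evalAt (Y : D.Uq) :
    (coeffMatrix hπ v).map (evalAt Y) = repMatrixHom π v Y := by
  ext i j
  exact (LinearMap.toMatrix_apply v.toBasis v.toBasis (π Y) i j).symm

theorem coeffMatrixStar_map_evalAt (hu : IsUnitary π) (Y : D.Uq) :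
    (coeffMatrixStar hπ v).map (evalAt Y) = repMatrixHom π v (HopfAlgebra.antipode ℂ Y) := by
  ext i j
  calc starRingEnd ℂ ((coeffMatrix hπ v).map (evalAt (starU (HopfAlgebra.antipode ℂ Y))) j i)
    _ = starRingEnd ℂ ⟪v j, π (starU (HopfAlgebra.antipode ℂ Y)) (v i)⟫_ℂ := by
      rw [coeffMatrix_map_evalAt, repMatrixHom_apply_eq_inner]
    _ = ⟪v i, π (HopfAlgebra.antipode ℂ Y) (v j)⟫_ℂ := by rw [← hu, inner_conj_symm]
    _ = _ := (repMatrixHom_apply_eq_inner v _ i j).symm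

theorem entrywise_rightAct_coeffMatrix (X : D.Uq) :
    entrywise D.rightModuleAlgebra.act (coeffMatrix hπ v) X =
      scalarMat D.CqG (repMatrixHom π v).toLinearMap X * coeffMatrix hπ v :=
  matrix_ext_evalAt fun Y => calc
    _ = (coeffMatrix hπ v).map (evalAt (X * Y)) := rfl
    _ = repMatrixHom π v X * (coeffMatrix hπ v).map (evalAt Y) := by
      rw [coeffMatrix_map_evalAt, coeffMatrix_map_evalAt, map_mul]
    _ = _ := (map_map_algebraMap_mul (evalAt Y) (repMatrixHom π v X) _).symm

theorem entrywise_leftAct_coeffMatrix (X : D.Uq) :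
    entrywise D.leftModuleAlgebra.act (coeffMatrix hπ v) X =
      coeffMatrix hπ v * scalarMat D.CqG (repMatrixHom π v).toLinearMap X :=
  matrix_ext_evalAt fun Y => calc
    _ = (coeffMatrix hπ v).map (evalAt (Y * X)) := rfl
    _ = (coeffMatrix hπ v).map (evalAt Y) * repMatrixHom π v X := by
      rw [coeffMatrix_map_evalAt, coeffMatrix_map_evalAt, map_mul]
    _ = _ := (map_mul_map_algebraMap (evalAt Y) _ (repMatrixHom π v X)).symm

theorem entrywise_rightAct_coeffMatrixStar (hu : IsUnitary π) (X : D.Uq) :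
    entrywise D.rightModuleAlgebra.act (coeffMatrixStar hπ v) X =
      coeffMatrixStar hπ v *
        scalarMat D.CqG ((repMatrixHom π v).toLinearMap ∘ₗ HopfAlgebra.antipode ℂ) X :=
  matrix_ext_evalAt fun Y => calc
    _ = (coeffMatrixStar hπ v).map (evalAt (X * Y)) := rfl
    _ = (coeffMatrixStar hπ v).map (evalAt Y) * repMatrixHom π v (HopfAlgebra.antipode ℂ X) := by
      rw [coeffMatrixStar_map_evalAt hπ v hu, coeffMatrixStar_map_evalAt hπ v hu,
        HopfAlgebra.antipode_mul_antidistrib, map_mul]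
    _ = _ := (map_mul_map_algebraMap (evalAt Y) _ _).symm

theorem entrywise_leftAct_coeffMatrixStar (hu : IsUnitary π) (X : D.Uq) :
    entrywise D.leftModuleAlgebra.act (coeffMatrixStar hπ v) X =
      scalarMat D.CqG ((repMatrixHom π v).toLinearMap ∘ₗ HopfAlgebra.antipode ℂ) X *
        coeffMatrixStar hπ v :=
  matrix_ext_evalAt fun Y => calc
    _ = (coeffMatrixStar hπ v).map (evalAt (Y * X)) := rfl
    _ = repMatrixHom π v (HopfAlgebra.antipode ℂ X) * (coeffMatrixStar hπ v).map (evalAt Y) := by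
      rw [coeffMatrixStar_map_evalAt hπ v hu, coeffMatrixStar_map_evalAt hπ v hu,
        HopfAlgebra.antipode_mul_antidistrib, map_mul]
    _ = _ := (map_map_algebraMap_mul (evalAt Y) _ _).symm

theorem isLeftInvariant_starCoeffConj (hu : IsUnitary π) (c : Matrix (Fin N) (Fin N) ℂ) :
    IsLeftInvariant D.leftModuleAlgebra (antipodeInvAntiRep (repMatrixHom π v))
      (antipodeInvAntiRep (repMatrixHom π v)) (starCoeffConj hπ v c) := by
  rw [starCoeffConj, Matrix.mul_assoc]
  refine isLeftInvariant_mul _ (entrywise_leftAct_coeffMatrixStar hπ v hu) fun X => ?_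
  rw [Matrix.mul_assoc, ← entrywise_leftAct_coeffMatrix]
  exact map_map_algebraMap_mul (D.leftModuleAlgebra.act X) c _

theorem isRightInvariant_coeffConj (hu : IsUnitary π) (c : Matrix (Fin N) (Fin N) ℂ) :
    IsRightInvariant D.rightModuleAlgebra (antipodeAntiRep (repMatrixHom π v))
      (antipodeAntiRep (repMatrixHom π v)) (coeffConj hπ v c) := by
  refine isRightInvariant_mul _ (fun X => ?_) (entrywise_rightAct_coeffMatrixStar hπ v hu)
  rw [← Matrix.mul_assoc, ← entrywise_rightAct_coeffMatrix]
  exact map_mul_map_algebraMap (D.rightModuleAlgebra.act X) _ c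

end CoeffMatrix

section MatrixUnits

variable {V : Type*} [NormedAddCommGroup V] [InnerProductSpace ℂ V] [FiniteDimensional ℂ V]
variable {N : ℕ} {π : D.Uq →ₐ[ℂ] Module.End ℂ V} {Λ : ι → ℕ}
variable (hπ : IsIrreducibleOfHighestWeight π Λ) (v : OrthonormalBasis (Fin N) ℂ V)

theorem matP_eq_starCoeffConj (c : Fin N → Fin N → ℂ) :
    matP hπ v c = starCoeffConj hπ.isTypeOne v (.of c) := by
  ext i j : 2
  simpa [matP, matM, starCoeffConj, coeffMatrixStar, coeffMatrix, u, Matrix.mul_apply,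
    Matrix.sum_apply, ← Algebra.commutes, ← Algebra.smul_def, Finset.sum_mul] using Finset.sum_comm

theorem matQ_eq_coeffConj (c : Fin N → Fin N → ℂ) :
    matQ hπ v c = coeffConj hπ.isTypeOne v (.of c) := by
  ext i j : 2
  simpa [matQ, matN, coeffConj, coeffMatrixStar, coeffMatrix, u, Matrix.mul_apply,
    Matrix.sum_apply, ← Algebra.commutes, ← Algebra.smul_def, Finset.sum_mul] using Finset.sum_comm

theorem matM_eq_starCoeffConj (n m : Fin N) :
    matM hπ v n m = starCoeffConj hπ.isTypeOne v (Matrix.single m n 1) := by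
  ext i j : 2
  simp [matM, starCoeffConj, coeffMatrixStar, coeffMatrix, u, Matrix.mul_apply,
    Matrix.single_apply, ite_and]

theorem matN_eq_coeffConj (n m : Fin N) :
    matN hπ v n m = coeffConj hπ.isTypeOne v (Matrix.single m n 1) := by
  ext i j : 2
  simp [matN, coeffConj, coeffMatrixStar, coeffMatrix, u, Matrix.mul_apply,
    Matrix.single_apply, ite_and]

end MatrixUnits

end Datum

end QuantumGroup

open QuantumGroup QuantumGroup.Datum in
theorem mainTheorem11_general {ι : Type*} {D : Datum ι} {K : D.Uqˣ}
    (hK : ∀ X : D.Uq, SemiconjBy (K : D.Uq) X (HopfAlgebra.antipode ℂ (HopfAlgebra.antipode ℂ X)))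
    {V : Type*} [NormedAddCommGroup V] [InnerProductSpace ℂ V] [FiniteDimensional ℂ V]
    {π : D.Uq →ₐ[ℂ] Module.End ℂ V} (hπ : IsTypeOne π) (hu : IsUnitary π)
    {N : ℕ} (v : OrthonormalBasis (Fin N) ℂ V) :
    (∃ ρ : D.Uqᵐᵒᵖ →ₐ[ℂ] Matrix (Fin N) (Fin N) ℂ,
      (∀ X : D.Uq, ρ (.op X) = repMatrix π v (↑K⁻¹ * HopfAlgebra.antipode ℂ X * K)) ∧
      (∀ c, IsLeftInvariant D.leftModuleAlgebra ρ ρ (starCoeffConj hπ v c)) ∧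
      ∀ c, IsIdempotentElem (starCoeffConj hπ v c) →
        ∃ x : LeftK0 D.leftModuleAlgebra, x.IsClassOf ρ (starCoeffConj hπ v c)) ∧
    (∃ ρ : D.Uqᵐᵒᵖ →ₐ[ℂ] Matrix (Fin N) (Fin N) ℂ,
      (∀ X : D.Uq, ρ (.op X) = repMatrix π v (K * AntipodeInverse.inv X * ↑K⁻¹)) ∧
      (∀ c, IsRightInvariant D.rightModuleAlgebra ρ ρ (coeffConj hπ v c)) ∧
      ∀ c, IsIdempotentElem (coeffConj hπ v c) →
        ∃ x : RightK0 D.rightModuleAlgebra, x.IsClassOf ρ (coeffConj hπ v c)) := by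
  have hP := isLeftInvariant_starCoeffConj hπ v hu
  have hQ := isRightInvariant_coeffConj hπ v hu
  refine ⟨⟨antipodeInvAntiRep (repMatrixHom π v), fun X => ?_, hP, fun c hc =>
      ⟨.of ⟨N, _, _, hc, hP c⟩, hc, hP c, rfl⟩⟩,
    ⟨antipodeAntiRep (repMatrixHom π v), fun X => ?_, hQ, fun c hc =>
      ⟨.of ⟨N, _, _, hc, hQ c⟩, hc, hQ c, rfl⟩⟩⟩
  · rw [conj_symm_antipode_eq_antipodeInv hK]
    rfl
  · rw [conj_antipodeInv_eq_antipode hK]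
    rfl

theorem mainTheorem11 {𝔤 : Type*} [LieRing 𝔤] [LieAlgebra ℂ 𝔤] [FiniteDimensional ℂ 𝔤]
    [LieAlgebra.IsSimple ℂ 𝔤] (𝔥 : LieSubalgebra ℂ 𝔤) [𝔥.IsCartanSubalgebra]
    (b : (LieAlgebra.IsKilling.rootSystem 𝔥).Base) (q : ℝ) (hq0 : 0 < q) (hq1 : q ≠ 1)
    (D : QuantumGroup.Datum b.support) (hD : D = QuantumGroup.Datum.ofBase b q hq0 hq1)
    (K2ρ : D.Uqˣ) (hK2ρ : K2ρ = D.Klam (QuantumGroup.twoRho b))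
    {V : Type*} [NormedAddCommGroup V] [InnerProductSpace ℂ V] [FiniteDimensional ℂ V]
    (π : D.Uq →ₐ[ℂ] Module.End ℂ V) (Λ : b.support → ℕ)
    (hπ : QuantumGroup.Datum.IsIrreducibleOfHighestWeight π Λ)
    (hu : QuantumGroup.Datum.IsUnitary π)
    {N : ℕ} (v : OrthonormalBasis (Fin N) ℂ V) :
    (∃ ρ : D.Uqᵐᵒᵖ →ₐ[ℂ] Matrix (Fin N) (Fin N) ℂ,
      (∀ X : D.Uq, ρ (MulOpposite.op X) = QuantumGroup.Datum.repMatrix π v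
        ((K2ρ⁻¹ : D.Uqˣ) * HopfAlgebra.antipode ℂ X * K2ρ)) ∧
      (∀ m n : Fin N, QuantumGroup.IsLeftInvariant D.leftModuleAlgebra ρ ρ
        (QuantumGroup.Datum.matM hπ v n m)) ∧
      ∀ c : Fin N → Fin N → ℂ, IsIdempotentElem (QuantumGroup.Datum.matP hπ v c) →
        ∃ x : QuantumGroup.LeftK0 D.leftModuleAlgebra,
          x.IsClassOf ρ (QuantumGroup.Datum.matP hπ v c)) ∧
    (∃ ρ : D.Uqᵐᵒᵖ →ₐ[ℂ] Matrix (Fin N) (Fin N) ℂ,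
      (∀ X : D.Uq, ρ (MulOpposite.op X) = QuantumGroup.Datum.repMatrix π v
        (K2ρ * QuantumGroup.AntipodeInverse.inv X * (K2ρ⁻¹ : D.Uqˣ))) ∧
      (∀ m n : Fin N, QuantumGroup.IsRightInvariant D.rightModuleAlgebra ρ ρ
        (QuantumGroup.Datum.matN hπ v n m)) ∧
      ∀ c : Fin N → Fin N → ℂ, IsIdempotentElem (QuantumGroup.Datum.matQ hπ v c) →
        ∃ x : QuantumGroup.RightK0 D.rightModuleAlgebra,
          x.IsClassOf ρ (QuantumGroup.Datum.matQ hπ v c)) := by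
  have sum_twoRho (j) : ∑ i, QuantumGroup.twoRho b i * D.a j i = 2 :=
    hD ▸ QuantumGroup.sum_twoRho_mul_cartanMatrix b j
  have hK := hK2ρ ▸ QuantumGroup.Datum.semiconjBy_Klam_antipode_antipode sum_twoRho
  obtain ⟨⟨ρL, hρL, hM, hP⟩, ⟨ρR, hρR, hN, hQ⟩⟩ := mainTheorem11_general hK hπ.isTypeOne hu v
  simp only [QuantumGroup.Datum.matM_eq_starCoeffConj, QuantumGroup.Datum.matP_eq_starCoeffConj,
    QuantumGroup.Datum.matN_eq_coeffConj, QuantumGroup.Datum.matQ_eq_coeffConj]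
  exact ⟨⟨ρL, hρL, fun m n => hM _, fun c => hP _⟩, ⟨ρR, hρR, fun m n => hN _, fun c => hQ _⟩⟩
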